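/- Let $p$ be a prime, let $C$ be a field of characteristic $p$, let $D$ be a central division algebra over $C$ of degree $n$ (that is, $\dim_C D=n^2<\infty$; $D=C$ is allowed), and let $\delta:D\to D$ be a derivation, i.e. an additive map with $\delta(ab)=a\delta(b)+\delta(a)b$. Then $\delta(C)\subseteq C$. Put $F=\{c\in C:\delta(c)=0\}$, a subfield of $C$, and assume that the $F$-linear map $\delta|_C:C\to C$ has minimum polynomial $t^p-t$ over $F$. Let $D[t;\delta]$ be the ring of polynomials $\sum a_it^i$ ($a_i\in D$) with multiplication determined by $ta=at+\delta(a)$. For $b\in D$ let $V_p(b)\in D$ be defined by $(t-b)^p=t^p-V_p(b)$ in $D[t;\delta]$. Let $d\in D$ and $f=t^p-t-d\in D[t;\delta]$. Let $(D,\delta,d)=D[t;\delta]/D[t;\delta]f$ be the set of all $g\in D[t;\delta]$ of degree less than $p$, with the usual addition, with multiplication $g\circ h=$ the remainder $r$ of $gh$ on right division by $f$ ($gh=qf+r$, $\deg r<p$), and with $F$ acting by left multiplication on coefficients; it is a unital nonassociative $F$-algebra. A nonzero nonassociative algebra is called a division algebra if left and right multiplication by every nonzero element are bijective. Then: 1.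 $(D,\delta,d)$ has dimension $n^2p^2$ over $F$. 2. $(D,\delta,d)$ is a division algebra if and only if $d\neq V_p(z)-z$ for all $z\in D$; equivalently, if and only if $d\neq t^p-(t-z)^p-z$ in $D[t;\delta]$ for all $z\in D$. 3. If moreover $\delta^p=\delta$ on all of $D$, then $(D,\delta,d)$ is associative if and only if $d\in F$. 4. The map $G_{\mathrm{id},-1}:\sum a_it^i\mapsto\sum a_i(t-1)^i$ is an $F$-algebra automorphism of $(D,\delta,d)$ which is the identity on $D$ and generates a cyclic subgroup of order $p$ of $\mathrm{Aut}_F((D,\delta,d))$. -/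

import Mathlib

open Polynomial

noncomputable section

namespace DiffAlg

universe u v

/-- A derivation of a (not necessarily commutative) ring: an additive map with
`δ (a b) = a δ(b) + δ(a) b`. -/
structure RingDerivation (D : Type u) [Ring D] extends D →+ D where
  leibniz' : ∀ a b : D, toFun (a * b) = a * toFun b + toFun a * b

namespace RingDerivation

instance (D : Type u) [Ring D] : FunLike (RingDerivation D) D D where
  coe δ := δ.toFun
  coe_injective := by
    rintro ⟨⟨⟨f, _⟩, _⟩, _⟩ ⟨⟨⟨g, _⟩, _⟩, _⟩ h
    cases h
    rfl

instance (D : Type u) [Ring D] : AddMonoidHomClass (RingDerivation D) D D where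
  map_add δ := δ.map_add'
  map_zero δ := δ.map_zero'

variable {D : Type u} [Ring D] (δ : RingDerivation D)

theorem leibniz (a b : D) : δ (a * b) = a * δ b + δ a * b := δ.leibniz' a b

theorem map_one : δ 1 = 0 := by
  have h := δ.leibniz 1 1
  simpa using h

end RingDerivation

/-! ### The field of constants and the restriction to the centre -/

section Centre

variable (C : Type v) [Field C] {D : Type u} [DivisionRing D] [Algebra C D]
  (δ : RingDerivation D)

/-- `F = {c ∈ C | δ(c) = 0}`, a subfield of `C`. -/
def constants : Subfield C where
  carrier := {c | δ (algebraMap C D c) = 0}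
  zero_mem' := by simp
  one_mem' := by simp [δ.map_one]
  add_mem' := by
    intro a b ha hb
    simp only [Set.mem_ofPred_eq] at *
    simp [ha, hb]
  mul_mem' := by
    intro a b ha hb
    simp only [Set.mem_ofPred_eq] at *
    simp [δ.leibniz, ha, hb]
  neg_mem' := by
    intro a ha
    simp only [Set.mem_ofPred_eq] at *
    simp [ha]
  inv_mem' := by
    intro a ha
    simp only [Set.mem_ofPred_eq] at *
    by_cases h : a = 0
    · simp [h]
    have h1 := δ.leibniz (algebraMap C D a) (algebraMap C D a⁻¹)
    rw [← map_mul, mul_inv_cancel₀ h, _root_.map_one, δ.map_one, ha, zero_mul, add_zero] at h1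
    rcases mul_eq_zero.mp h1.symm with h2 | h2
    · exact absurd ((map_eq_zero _).mp h2) h
    · exact h2

theorem mem_constants {c : C} : c ∈ constants C δ ↔ δ (algebraMap C D c) = 0 := Iff.rfl

/-- A derivation maps the centre to itself. -/
theorem exists_algebraMap_eq [Algebra.IsCentral C D] (c : C) :
    ∃ c' : C, algebraMap C D c' = δ (algebraMap C D c) := by
  have h : δ (algebraMap C D c) ∈ Subalgebra.center C D := by
    rw [Subalgebra.mem_center_iff]
    intro b
    have h1 := δ.leibniz (algebraMap C D c) b
    have h2 := δ.leibniz b (algebraMap C D c)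
    rw [Algebra.commutes c b] at h1
    rw [h1, Algebra.commutes c (δ b), add_comm (δ b * _)] at h2
    exact (add_right_cancel h2).symm
  have h' := Algebra.IsCentral.out (K := C) (D := D) h
  exact Algebra.mem_bot.mp h'

/-- The restriction of `δ` to `C`, as a map. -/
def restrictFun [Algebra.IsCentral C D] (c : C) : C := (exists_algebraMap_eq C δ c).choose

theorem algebraMap_restrictFun [Algebra.IsCentral C D] (c : C) :
    algebraMap C D (restrictFun C δ c) = δ (algebraMap C D c) :=
  (exists_algebraMap_eq C δ c).choose_spec

/-- `δ|_C`, as an `F`-linear endomorphism of `C`. -/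
def restrictCentre [Algebra.IsCentral C D] : C →ₗ[constants C δ] C where
  toFun := restrictFun C δ
  map_add' a b := by
    apply (algebraMap C D).injective
    simp [algebraMap_restrictFun]
  map_smul' a b := by
    apply (algebraMap C D).injective
    have ha : δ (algebraMap C D (a : C)) = 0 := a.2
    simp [algebraMap_restrictFun, Subfield.smul_def, δ.leibniz, ha]

theorem algebraMap_restrictCentre [Algebra.IsCentral C D] (c : C) :
    algebraMap C D (restrictCentre C δ c) = δ (algebraMap C D c) :=
  (exists_algebraMap_eq C δ c).choose_spec

end Centre

/-! ### The differential polynomial ring -/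

section Ring

variable {D : Type u} [DivisionRing D] (δ : RingDerivation D)

/-- Left multiplication by `t` on polynomials with left coefficients:
`t (∑ aᵢ tⁱ) = ∑ aᵢ tⁱ⁺¹ + ∑ δ(aᵢ) tⁱ`. -/
def tMul : D[X] →+ D[X] where
  toFun g := g * X + g.sum fun i a => monomial i (δ a)
  map_zero' := by simp
  map_add' g h := by
    rw [Polynomial.sum_add_index g h _ (by simp) (by simp), add_mul]
    abel

theorem coeff_tMul (g : D[X]) (n : ℕ) :
    (tMul δ g).coeff n = (g * X).coeff n + δ (g.coeff n) := by
  change (g * X + g.sum fun i a => monomial i (δ a)).coeff n = _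
  rw [coeff_add, Polynomial.sum_def, finsetSum_coeff]
  congr 1
  simp only [coeff_monomial]
  rw [Finset.sum_ite_eq' g.support n]
  split_ifs with h
  · rfl
  · rw [notMem_support_iff.mp h, map_zero]

/-- The product of `D[t;δ]`: `(∑ aᵢ tⁱ) g = ∑ aᵢ (tⁱ g)`. -/
def mulFun (f g : D[X]) : D[X] := f.sum fun i a => Polynomial.C a * (tMul δ)^[i] g

theorem iterate_tMul_add (i : ℕ) (g h : D[X]) :
    (tMul δ)^[i] (g + h) = (tMul δ)^[i] g + (tMul δ)^[i] h := by
  induction i generalizing g h with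
  | zero => rfl
  | succ i ih => simp only [Function.iterate_succ, Function.comp, map_add, ih]

theorem mulFun_add_left (f g h : D[X]) : mulFun δ (f + g) h = mulFun δ f h + mulFun δ g h := by
  unfold mulFun
  rw [Polynomial.sum_add_index]
  · simp
  · intro i a b
    rw [map_add, add_mul]

theorem mulFun_add_right (f g h : D[X]) : mulFun δ f (g + h) = mulFun δ f g + mulFun δ f h := by
  unfold mulFun
  simp only [Polynomial.sum_def, iterate_tMul_add, mul_add, Finset.sum_add_distrib]

theorem mulFun_monomial (i : ℕ) (a : D) (g : D[X]) :
    mulFun δ (monomial i a) g = Polynomial.C a * (tMul δ)^[i] g := by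
  unfold mulFun
  rw [Polynomial.sum_monomial_index]
  simp

theorem zero_mulFun (g : D[X]) : mulFun δ 0 g = 0 := by simp [mulFun]

theorem mulFun_C_mul (a : D) (f g : D[X]) :
    mulFun δ (Polynomial.C a * f) g = Polynomial.C a * mulFun δ f g := by
  induction f using Polynomial.induction_on' with
  | add p q hp hq => rw [mul_add, mulFun_add_left, mulFun_add_left, mul_add, hp, hq]
  | monomial n b => rw [C_mul_monomial, mulFun_monomial, mulFun_monomial, map_mul, mul_assoc]

theorem tMul_C_mul (a : D) (g : D[X]) :
    tMul δ (Polynomial.C a * g) = Polynomial.C a * tMul δ g + Polynomial.C (δ a) * g := by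
  ext n
  simp only [coeff_tMul, coeff_add, coeff_C_mul, mul_assoc, δ.leibniz]
  rw [mul_add]
  abel

theorem tMul_monomial (i : ℕ) (a : D) :
    tMul δ (monomial i a) = monomial (i + 1) a + monomial i (δ a) := by
  change monomial i a * X + (monomial i a).sum (fun i a => monomial i (δ a)) = _
  rw [Polynomial.sum_monomial_index _ _ (by simp), monomial_mul_X]

theorem mulFun_tMul (f g : D[X]) : mulFun δ (tMul δ f) g = tMul δ (mulFun δ f g) := by
  induction f using Polynomial.induction_on' with
  | add p q hp hq => simp only [map_add, mulFun_add_left, hp, hq]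
  | monomial n b =>
    rw [tMul_monomial, mulFun_add_left, mulFun_monomial, mulFun_monomial, mulFun_monomial,
      tMul_C_mul, Function.iterate_succ_apply']

theorem mulFun_iterate_tMul (i : ℕ) (f g : D[X]) :
    mulFun δ ((tMul δ)^[i] f) g = (tMul δ)^[i] (mulFun δ f g) := by
  induction i with
  | zero => rfl
  | succ i ih => rw [Function.iterate_succ_apply', mulFun_tMul, ih, Function.iterate_succ_apply']

theorem mulFun_assoc (f g h : D[X]) : mulFun δ (mulFun δ f g) h = mulFun δ f (mulFun δ g h) := by
  induction f using Polynomial.induction_on' with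
  | add p q hp hq => simp only [mulFun_add_left, hp, hq]
  | monomial n b =>
    rw [mulFun_monomial, mulFun_monomial, mulFun_C_mul, mulFun_iterate_tMul]

theorem iterate_tMul_one (i : ℕ) : (tMul δ)^[i] 1 = X ^ i := by
  induction i with
  | zero => simp
  | succ i ih =>
    rw [Function.iterate_succ_apply', ih, ← monomial_one_right_eq_X_pow, tMul_monomial, δ.map_one,
      map_zero, add_zero, monomial_one_right_eq_X_pow]

theorem one_mulFun (g : D[X]) : mulFun δ 1 g = g := by
  have := mulFun_monomial δ 0 1 g
  simpa using this

theorem mulFun_one (f : D[X]) : mulFun δ f 1 = f := by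
  induction f using Polynomial.induction_on' with
  | add p q hp hq => rw [mulFun_add_left, hp, hq]
  | monomial n b => rw [mulFun_monomial, iterate_tMul_one, C_mul_X_pow_eq_monomial]

/-- The differential polynomial ring `D[t;δ]`: polynomials `∑ aᵢ tⁱ` with left coefficients in
`D`, termwise addition, and the multiplication determined by `t a = a t + δ(a)`. -/
def DiffPoly (_δ : RingDerivation D) : Type u := D[X]

namespace DiffPoly

variable {δ}

instance : AddCommGroup (DiffPoly δ) := inferInstanceAs (AddCommGroup D[X])

instance : Ring (DiffPoly δ) where
  __ := (inferInstance : AddCommGroup (DiffPoly δ))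
  mul f g := mulFun δ f g
  one := (1 : D[X])
  left_distrib := mulFun_add_right δ
  right_distrib := mulFun_add_left δ
  zero_mul := zero_mulFun δ
  mul_zero f := by
    have h := mulFun_add_right δ f 0 0
    rw [add_zero] at h
    exact left_eq_add.mp h
  mul_assoc := mulFun_assoc δ
  one_mul := one_mulFun δ
  mul_one := mulFun_one δ

/-- The underlying polynomial. -/
def toPoly : DiffPoly δ ≃+ D[X] := AddEquiv.refl _

theorem toPoly_mul (f g : DiffPoly δ) : toPoly (f * g) = mulFun δ (toPoly f) (toPoly g) := rfl

theorem toPoly_one : toPoly (1 : DiffPoly δ) = 1 := rfl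

variable (δ) in
/-- The constant polynomials, `D ⊆ D[t;δ]`. -/
def const : D →+* DiffPoly δ where
  toFun a := toPoly.symm (Polynomial.C a)
  map_zero' := Polynomial.C_0
  map_one' := Polynomial.C_1
  map_add' _ _ := Polynomial.C_add
  map_mul' a b := by
    apply toPoly.injective
    rw [toPoly_mul]
    change Polynomial.C (a * b) = mulFun δ (monomial 0 a) (Polynomial.C b)
    rw [mulFun_monomial]
    simp

variable (δ) in
/-- The indeterminate `t`. -/
def t : DiffPoly δ := toPoly.symm X

/-- The defining relation `t a = a t + δ(a)`. -/
theorem t_mul_const (a : D) : t δ * const δ a = const δ a * t δ + const δ (δ a) := by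
  apply toPoly.injective
  rw [map_add, toPoly_mul, toPoly_mul]
  change mulFun δ X (Polynomial.C a) = mulFun δ (monomial 0 a) X + Polynomial.C (δ a)
  rw [← monomial_one_one_eq_X, mulFun_monomial, mulFun_monomial]
  change _ * tMul δ (monomial 0 a) = _ * monomial 1 1 + _
  rw [tMul_monomial]
  simp [C_mul_monomial]

theorem toPoly_t_pow (k : ℕ) : toPoly (t δ ^ k) = X ^ k := by
  induction k with
  | zero => rw [pow_zero, pow_zero]; rfl
  | succ k ih =>
    rw [pow_succ', toPoly_mul, ih]
    change mulFun δ X (X ^ k) = _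
    rw [← iterate_tMul_one δ k, ← monomial_one_one_eq_X, mulFun_monomial,
      ← Function.iterate_add_apply, iterate_tMul_one, map_one, one_mul, monomial_one_one_eq_X]
    rw [add_comm]

/-- The degree of a differential polynomial, `-∞` for `0`. -/
def degree (g : DiffPoly δ) : WithBot ℕ := (toPoly g).degree

/-- `f` is monic. -/
def Monic (f : DiffPoly δ) : Prop := (toPoly f).Monic

/-- The degree as a natural number, `0` for `0`. -/
def natDegree (g : DiffPoly δ) : ℕ := (toPoly g).natDegree

variable (δ) in
/-- `G_{τ,a} (∑ aᵢ tⁱ) = ∑ τ(aᵢ) (t + a)ⁱ`. -/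
def G (τ : D ≃+* D) (a : D) (g : DiffPoly δ) : DiffPoly δ :=
  (toPoly g).sum fun i b => const δ (τ b) * (t δ + const δ a) ^ i

variable (δ) in
/-- `V_p(b)`, the element of `D` with `(t - b)^p = t^p - V_p(b)` when `D` has characteristic `p`,
obtained as the constant coefficient of `t^p - (t - b)^p`. -/
def V (p : ℕ) (b : D) : D := (toPoly (t δ ^ p - (t δ - const δ b) ^ p)).coeff 0

/-! ### Right division by a monic polynomial -/

theorem coeff_iterate_tMul {f : D[X]} (hf : f.Monic) (i : ℕ) :
    ((tMul δ)^[i] f).coeff (f.natDegree + i) = 1 ∧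
      ∀ n, f.natDegree + i < n → ((tMul δ)^[i] f).coeff n = 0 := by
  induction i with
  | zero => exact ⟨hf.coeff_natDegree, fun n hn => coeff_eq_zero_of_natDegree_lt hn⟩
  | succ i ih =>
    rw [Function.iterate_succ_apply']
    constructor
    · rw [coeff_tMul, ← add_assoc, coeff_mul_X, ih.1, ih.2 _ (Nat.lt_succ_self _), map_zero,
        add_zero]
    · intro n hn
      obtain ⟨k, rfl⟩ : ∃ k, n = k + 1 := ⟨n - 1, by omega⟩
      rw [coeff_tMul, coeff_mul_X, ih.2 k (by omega), ih.2 (k + 1) (by omega), map_zero, add_zero]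

/-- Existence in the right division algorithm. -/
theorem exists_rem {f : DiffPoly δ} (hf : f.Monic) (g : DiffPoly δ) :
    ∃ r : DiffPoly δ, degree r < (natDegree f : WithBot ℕ) ∧ ∃ q, g = q * f + r := by
  suffices H : ∀ (k : ℕ) (g : DiffPoly δ), degree g < (k : WithBot ℕ) →
      ∃ r : DiffPoly δ, degree r < (natDegree f : WithBot ℕ) ∧ ∃ q, g = q * f + r by
    apply H ((toPoly g).natDegree + 1)
    exact lt_of_le_of_lt degree_le_natDegree (by exact_mod_cast Nat.lt_succ_self _)
  intro k
  induction k with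
  | zero =>
    intro g hg
    refine ⟨g, lt_of_lt_of_le hg (by simp), 0, by rw [zero_mul, zero_add]⟩
  | succ k ih =>
    intro g hg
    by_cases hk : k + 1 ≤ natDegree f
    · exact ⟨g, lt_of_lt_of_le hg (by exact_mod_cast hk), 0, by rw [zero_mul, zero_add]⟩
    obtain ⟨j, hj⟩ : ∃ j, k = natDegree f + j := ⟨k - natDegree f, by omega⟩
    let q₀ : DiffPoly δ := toPoly.symm (monomial j ((toPoly g).coeff k))
    have hq : toPoly (q₀ * f) = Polynomial.C ((toPoly g).coeff k) * (tMul δ)^[j] (toPoly f) := by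
      rw [toPoly_mul]
      exact mulFun_monomial δ j _ _
    have hc := coeff_iterate_tMul (δ := δ) hf j
    obtain ⟨r, hr, q, hq'⟩ := ih (g - q₀ * f) (by
      refine (degree_lt_iff_coeff_zero _ _).mpr fun n hn => ?_
      rw [map_sub, coeff_sub, hq, coeff_C_mul]
      rcases hn.eq_or_lt with rfl | hn'
      · have := hc.1
        rw [show (toPoly f).natDegree + j = k from hj.symm] at this
        rw [this, mul_one, sub_self]
      · have := hc.2 n (by rw [show (toPoly f).natDegree + j = k from hj.symm]; exact hn')
        rw [this, mul_zero, sub_zero]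
        exact (degree_lt_iff_coeff_zero _ _).mp hg n hn')
    refine ⟨r, hr, q + q₀, ?_⟩
    rw [add_mul, add_right_comm, ← hq', sub_add_cancel]

theorem eq_zero_of_mul_degree_lt {f : DiffPoly δ} (hf : f.Monic) {q : DiffPoly δ}
    (h : degree (q * f) < (natDegree f : WithBot ℕ)) : q = 0 := by
  by_contra hq
  have hq' : toPoly q ≠ 0 := fun h => hq (toPoly.injective h)
  have h0 : (toPoly (q * f)).coeff (natDegree f + (toPoly q).natDegree) = 0 :=
    (degree_lt_iff_coeff_zero _ _).mp h _ (Nat.le_add_right _ _)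
  rw [toPoly_mul, mulFun, Polynomial.sum_def, finsetSum_coeff,
    Finset.sum_eq_single (toPoly q).natDegree] at h0
  · rw [coeff_C_mul, natDegree, (coeff_iterate_tMul hf _).1, mul_one] at h0
    exact hq' (leadingCoeff_eq_zero.mp h0)
  · intro i hi hne
    have : i < (toPoly q).natDegree := lt_of_le_of_ne (le_natDegree_of_mem_supp i hi) hne
    rw [coeff_C_mul, (coeff_iterate_tMul hf i).2 _ (by unfold natDegree; omega), mul_zero]
  · intro hn
    rw [notMem_support_iff.mp hn]
    simp

/-- Uniqueness in the right division algorithm. -/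
theorem rem_unique {f : DiffPoly δ} (hf : f.Monic) {r r' q q' : DiffPoly δ}
    (hr : degree r < (natDegree f : WithBot ℕ)) (hr' : degree r' < (natDegree f : WithBot ℕ))
    (h : q * f + r = q' * f + r') : r = r' := by
  have h1 : (q - q') * f = r' - r := by
    rw [sub_mul, sub_eq_sub_iff_add_eq_add, h]
    abel
  have h2 : q - q' = 0 := by
    apply eq_zero_of_mul_degree_lt hf
    rw [h1]
    exact lt_of_le_of_lt (degree_sub_le _ _) (max_lt hr' hr)
  rw [h2, zero_mul] at h1
  exact (sub_eq_zero.mp h1.symm).symm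

/-- `g mod_r f`: the remainder `r` of the right division `g = q f + r`, `deg r < deg f`. -/
def modR {f : DiffPoly δ} (hf : f.Monic) (g : DiffPoly δ) : DiffPoly δ := (exists_rem hf g).choose

theorem modR_degree {f : DiffPoly δ} (hf : f.Monic) (g : DiffPoly δ) :
    degree (modR hf g) < (natDegree f : WithBot ℕ) := (exists_rem hf g).choose_spec.1

theorem exists_modR {f : DiffPoly δ} (hf : f.Monic) (g : DiffPoly δ) :
    ∃ q, g = q * f + modR hf g := (exists_rem hf g).choose_spec.2

theorem modR_eq {f : DiffPoly δ} (hf : f.Monic) {g q r : DiffPoly δ}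
    (hr : degree r < (natDegree f : WithBot ℕ)) (h : g = q * f + r) : modR hf g = r := by
  obtain ⟨q', hq'⟩ := exists_modR hf g
  exact rem_unique hf (modR_degree hf g) hr (hq'.symm.trans h)

theorem modR_add {f : DiffPoly δ} (hf : f.Monic) (g h : DiffPoly δ) :
    modR hf (g + h) = modR hf g + modR hf h := by
  obtain ⟨q, hq⟩ := exists_modR hf g
  obtain ⟨q', hq'⟩ := exists_modR hf h
  refine modR_eq hf (q := q + q')
    (lt_of_le_of_lt (degree_add_le _ _) (max_lt (modR_degree hf g) (modR_degree hf h))) ?_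
  rw [add_mul, add_add_add_comm, ← hq, ← hq']

theorem modR_self {f : DiffPoly δ} (hf : f.Monic) {g : DiffPoly δ}
    (hg : degree g < (natDegree f : WithBot ℕ)) : modR hf g = g :=
  modR_eq hf (q := 0) hg (by rw [zero_mul, zero_add])

theorem modR_const_mul {f : DiffPoly δ} (hf : f.Monic) (a : D) (g : DiffPoly δ) :
    modR hf (const δ a * g) = const δ a * modR hf g := by
  obtain ⟨q, hq⟩ := exists_modR hf g
  refine modR_eq hf (q := const δ a * q) ?_ ?_
  · refine (degree_lt_iff_coeff_zero _ _).mpr fun n hn => ?_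
    have h0 := (degree_lt_iff_coeff_zero _ _).mp (modR_degree hf g) n hn
    change (mulFun δ (monomial 0 a) (toPoly (modR hf g))).coeff n = 0
    rw [mulFun_monomial, coeff_C_mul]
    simp [h0]
  · rw [mul_assoc, ← mul_add, ← hq]

end DiffPoly

/-! ### Petit algebras -/

open DiffPoly

variable {δ}

/-- `R_m = {g ∈ D[t;δ] | deg g < m}`. -/
def lowDegree (δ : RingDerivation D) (m : ℕ) : AddSubgroup (DiffPoly δ) where
  carrier := {g | DiffPoly.degree g < (m : WithBot ℕ)}
  zero_mem' := by
    change (0 : D[X]).degree < _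
    simp
  add_mem' ha hb := lt_of_le_of_lt (degree_add_le _ _) (max_lt ha hb)
  neg_mem' {a} ha := by
    change (-(toPoly a)).degree < _
    rw [degree_neg]
    exact ha

/-- The Petit algebra `S_f = D[t;δ]/D[t;δ]f` of a monic `f` of degree `m`: the additive group
`R_m` with the multiplication `g ∘ h = g h mod_r f`. -/
def Petit (f : DiffPoly δ) (_hf : f.Monic) : Type u := lowDegree δ (DiffPoly.natDegree f)

namespace Petit

variable {f : DiffPoly δ} {hf : f.Monic}

instance : AddCommGroup (Petit f hf) := inferInstanceAs (AddCommGroup (lowDegree δ (DiffPoly.natDegree f)))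

/-- The inclusion `S_f = R_m ⊆ D[t;δ]`, an additive map. -/
def val : Petit f hf →+ DiffPoly δ := (lowDegree δ (DiffPoly.natDegree f)).subtype

theorem val_injective : Function.Injective (val : Petit f hf →+ DiffPoly δ) := Subtype.val_injective

theorem degree_val (x : Petit f hf) : DiffPoly.degree x.val < (DiffPoly.natDegree f : WithBot ℕ) := x.2

/-- The class `g mod_r f` in `S_f` of a polynomial `g`. -/
def mk (g : DiffPoly δ) : Petit f hf := ⟨modR hf g, modR_degree hf g⟩

theorem val_mk (g : DiffPoly δ) : (mk g : Petit f hf).val = modR hf g := rfl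

instance : Mul (Petit f hf) := ⟨fun x y => mk (x.val * y.val)⟩

instance : One (Petit f hf) := ⟨mk 1⟩

theorem val_mul (x y : Petit f hf) : (x * y).val = modR hf (x.val * y.val) := rfl

theorem val_one : (1 : Petit f hf).val = modR hf 1 := rfl

theorem one_dichotomy (x : Petit f hf) : x = 0 ∨ (1 : Petit f hf).val = 1 := by
  by_cases h : DiffPoly.natDegree f = 0
  · left
    apply val_injective
    have := degree_val x
    rw [h] at this
    have h2 : toPoly x.val = 0 := by
      apply degree_eq_bot.mp
      have h3 : (toPoly x.val).degree < 0 := this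
      exact Nat.WithBot.lt_zero_iff.mp h3
    exact toPoly.injective h2
  · right
    refine modR_self hf ?_
    change (1 : D[X]).degree < ((DiffPoly.natDegree f : ℕ) : WithBot ℕ)
    rw [degree_one]
    exact_mod_cast Nat.pos_of_ne_zero h

instance : NonAssocRing (Petit f hf) where
  __ := (inferInstance : AddCommGroup (Petit f hf))
  left_distrib x y z := by
    apply val_injective
    rw [map_add, val_mul, val_mul, val_mul, map_add, mul_add, modR_add]
  right_distrib x y z := by
    apply val_injective
    rw [map_add, val_mul, val_mul, val_mul, map_add, add_mul, modR_add]
  zero_mul x := by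
    apply val_injective
    rw [val_mul, map_zero, zero_mul]
    exact modR_self hf (lowDegree δ (DiffPoly.natDegree f)).zero_mem
  mul_zero x := by
    apply val_injective
    rw [val_mul, map_zero, mul_zero]
    exact modR_self hf (lowDegree δ (DiffPoly.natDegree f)).zero_mem
  one_mul x := by
    apply val_injective
    rcases one_dichotomy x with rfl | h
    · rw [val_mul, map_zero, mul_zero]
      exact modR_self hf (lowDegree δ (DiffPoly.natDegree f)).zero_mem
    · rw [val_mul, h, one_mul, modR_self hf (degree_val x)]
  mul_one x := by
    apply val_injective
    rcases one_dichotomy x with rfl | h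
    · rw [val_mul, map_zero, zero_mul]
      exact modR_self hf (lowDegree δ (DiffPoly.natDegree f)).zero_mem
    · rw [val_mul, h, mul_one, modR_self hf (degree_val x)]

/-! `S_f` is a unital algebra over `F`, with `c ∑ aᵢ tⁱ = ∑ (c aᵢ) tⁱ`. -/

section Algebra

variable {C : Type v} [Field C] [Algebra C D]

instance : SMul (constants C δ) (Petit f hf) :=
  ⟨fun c x => mk (const δ (algebraMap C D c) * x.val)⟩

theorem val_smul (c : constants C δ) (x : Petit f hf) :
    (c • x).val = const δ (algebraMap C D c) * x.val := by
  change modR hf _ = _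
  rw [modR_const_mul, modR_self hf (degree_val x)]

instance : Module (constants C δ) (Petit f hf) where
  one_smul x := val_injective (by simp [val_smul])
  mul_smul a b x := val_injective (by simp [val_smul, mul_assoc])
  smul_zero a := val_injective (by simp [val_smul])
  smul_add a x y := val_injective (by simp [val_smul, mul_add])
  add_smul a b x := val_injective (by simp [val_smul, add_mul])
  zero_smul x := val_injective (by simp [val_smul])

theorem commute_const (c : constants C δ) (g : DiffPoly δ) :
    g * const δ (algebraMap C D c) = const δ (algebraMap C D c) * g := by
  have hc : δ (algebraMap C D (c : C)) = 0 := c.2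
  have key : ∀ P : D[X], mulFun δ P (Polynomial.C (algebraMap C D c)) =
      Polynomial.C (algebraMap C D c) * P := by
    intro P
    induction P using Polynomial.induction_on' with
    | add p q hp hq => rw [mulFun_add_left, hp, hq, mul_add]
    | monomial n b =>
      rw [mulFun_monomial]
      have : (tMul δ)^[n] (Polynomial.C (algebraMap C D c)) =
          Polynomial.C (algebraMap C D (c : C)) * X ^ n := by
        rw [← iterate_tMul_one δ n]
        have h : ∀ g : D[X], tMul δ (Polynomial.C (algebraMap C D (c : C)) * g) =
            Polynomial.C (algebraMap C D (c : C)) * tMul δ g := by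
          intro g
          rw [tMul_C_mul, hc]
          simp
        clear * - h
        induction n with
        | zero => simp
        | succ n ih => rw [Function.iterate_succ_apply', ih, h, Function.iterate_succ_apply']
      rw [this, ← mul_assoc, ← map_mul, ← Algebra.commutes, C_mul_X_pow_eq_monomial,
        C_mul_monomial]
  apply toPoly.injective
  rw [toPoly_mul, toPoly_mul]
  refine (key (toPoly g)).trans ?_
  change _ = mulFun δ (monomial 0 _) _
  rw [mulFun_monomial]
  rfl

instance : IsScalarTower (constants C δ) (Petit f hf) (Petit f hf) where
  smul_assoc c x y := val_injective (by
    simp only [smul_eq_mul, val_smul, val_mul, mul_assoc, modR_const_mul])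

instance : SMulCommClass (constants C δ) (Petit f hf) (Petit f hf) where
  smul_comm c x y := val_injective (by
    simp only [smul_eq_mul, val_smul, val_mul]
    rw [← mul_assoc, commute_const, mul_assoc, modR_const_mul])

end Algebra

end Petit

/-! ### The algebra `(D, δ, d)` -/

theorem monic_diffExt (δ : RingDerivation D) (p : ℕ) [Fact p.Prime] (d : D) :
    (t δ ^ p - t δ - const δ d).Monic := by
  unfold DiffPoly.Monic
  rw [map_sub, map_sub, toPoly_t_pow]
  change (X ^ p - X - Polynomial.C d).Monic
  rw [sub_sub]
  apply monic_X_pow_sub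
  have hp := (Fact.out : p.Prime).two_le
  refine lt_of_le_of_lt (degree_add_le _ _) (max_lt ?_ ?_)
  · rw [degree_X]
    exact_mod_cast hp
  · exact lt_of_le_of_lt degree_C_le (by exact_mod_cast (by omega : 0 < p))

/-- `(D, δ, d) = D[t;δ]/D[t;δ]f` with `f = t^p - t - d`. -/
abbrev GenDiffAlg (δ : RingDerivation D) (p : ℕ) [Fact p.Prime] (d : D) : Type u :=
  Petit (t δ ^ p - t δ - const δ d) (monic_diffExt δ p d)

end Ring

/-! ### Nonassociative algebras -/

/-- A nonzero nonassociative ring in which all left and right multiplications with nonzero elements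
are bijective. -/
def IsDivisionAlgebra (A : Type u) [NonAssocRing A] : Prop :=
  Nontrivial A ∧ ∀ a : A, a ≠ 0 →
    Function.Bijective (fun x => a * x) ∧ Function.Bijective (fun x => x * a)

/-- Associativity of the multiplication. -/
def IsAssociativeAlgebra (A : Type u) [NonAssocRing A] : Prop :=
  ∀ x y z : A, x * y * z = x * (y * z)

/-- `Aut_F(A)`, the group of `F`-algebra automorphisms of a nonassociative algebra `A`. -/
def Aut (F : Type v) (A : Type u) [Field F] [NonAssocRing A] [Module F A] :
    Subgroup (A ≃ₗ[F] A) where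
  carrier := {φ | ∀ x y, φ (x * y) = φ x * φ y}
  one_mem' _ _ := rfl
  mul_mem' {φ ψ} hφ hψ x y := by
    change φ (ψ (x * y)) = φ (ψ x) * φ (ψ y)
    rw [hψ, hφ]
  inv_mem' {φ} hφ x y := by
    apply φ.injective
    change φ (φ.symm (x * y)) = φ (φ.symm x * φ.symm y)
    rw [hφ]
    simp

end DiffAlg

end

/-! Write R = D[t;δ]. The quotient R/Rf is a left R-module of D-dimension p, and right
multiplications in `Petit` are D-linear, so division questions become questions about the
R-submodules (`IsStable`) of R/Rf. The substitution σ : t ↦ t - 1 is a ring automorphism of R that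
fixes f, because (t - 1)^p = t^p - 1, and it therefore acts on R/Rf.

Division criterion. No submodule other than 0 and the whole space is σ-invariant: for a monic l of
least degree k > 0 in it, σ(l) - l would have degree k - 1 and leading coefficient -k ≠ 0
(`IsStable.eq_top_of_shift_mem`). Hence the proper submodules of maximal dimension, which σ
permutes, intersect in 0. Intersecting them one at a time lowers the dimension by 0 or by their
common codimension, so this codimension divides p (`codim_dvd_finrank`). If it is p, then R/Rf is
simple and S_f has no zero divisors (`Petit.eq_zero_of_mul_eq_zero`). If it is 1, then some t - z
lies in a proper submodule, and right division of f by t - z leaves the constant V_p(z) - z - d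
(`diffExt_eq`), which must vanish. Conversely, when it vanishes, f factors and zero divisors appear.

Dimension. Since t^p - t splits over F with simple roots 0, ..., p - 1, C is the sum of the
eigenspaces of δ. If δ(w) = w ≠ 0, the i-th eigenspace is F w^i, so [C : F] = p
(`finrank_constants`); multiply along F ⊆ C ⊆ D ⊆ S_f.

Associativity. When δ^p = δ, the commutators of f with constants and with t are the constants ad -
da and δ(d). If they vanish, Rf is two-sided; conversely, associativity forces fa, ft ∈ Rf and hence
their vanishing.

Automorphism. σ^k is t ↦ t - k, so σ has order p. -/

noncomputable section

namespace DiffAlg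

universe u v

/-! ### Coefficients of differential polynomials -/

namespace DiffPoly

variable {D : Type u} [DivisionRing D] {δ : RingDerivation D}

/-- The coefficient of `t ^ n`. -/
def coeff (g : DiffPoly δ) (n : ℕ) : D := (toPoly g).coeff n

theorem ext_coeff {g h : DiffPoly δ} (H : ∀ n, coeff g n = coeff h n) : g = h :=
  toPoly.injective (Polynomial.ext H)

@[simp] theorem coeff_zero (n : ℕ) : coeff (0 : DiffPoly δ) n = 0 := Polynomial.coeff_zero n

@[simp] theorem coeff_add (g h : DiffPoly δ) (n : ℕ) :
    coeff (g + h) n = coeff g n + coeff h n := Polynomial.coeff_add _ _ n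

@[simp] theorem coeff_sub (g h : DiffPoly δ) (n : ℕ) :
    coeff (g - h) n = coeff g n - coeff h n := by
  simp only [coeff, map_sub, Polynomial.coeff_sub]

theorem coeff_const (a : D) (n : ℕ) : coeff (const δ a) n = if n = 0 then a else 0 :=
  Polynomial.coeff_C

theorem coeff_one (n : ℕ) : coeff (1 : DiffPoly δ) n = if n = 0 then 1 else 0 := by
  rw [← map_one (const δ), coeff_const]

theorem toPoly_const_mul (a : D) (g : DiffPoly δ) :
    toPoly (const δ a * g) = Polynomial.C a * toPoly g := by
  exact mulFun_monomial δ 0 a (toPoly g)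

theorem toPoly_t_mul (g : DiffPoly δ) : toPoly (t δ * g) = tMul δ (toPoly g) := by
  have h := mulFun_monomial δ 1 1 (toPoly g)
  rw [monomial_one_one_eq_X, map_one, one_mul] at h
  exact h

@[simp] theorem coeff_const_mul (a : D) (g : DiffPoly δ) (n : ℕ) :
    coeff (const δ a * g) n = a * coeff g n := by
  rw [coeff, toPoly_const_mul, coeff_C_mul, coeff]

@[simp] theorem coeff_t_mul_zero (g : DiffPoly δ) : coeff (t δ * g) 0 = δ (coeff g 0) := by
  rw [coeff, toPoly_t_mul, coeff_tMul, mul_coeff_zero, coeff_X_zero, mul_zero, zero_add, coeff]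

@[simp] theorem coeff_t_mul_succ (g : DiffPoly δ) (n : ℕ) :
    coeff (t δ * g) (n + 1) = coeff g n + δ (coeff g (n + 1)) := by
  rw [coeff, toPoly_t_mul, coeff_tMul, coeff_mul_X, coeff, coeff]

theorem coeff_t_pow (k n : ℕ) : coeff (t δ ^ k) n = if n = k then 1 else 0 := by
  rw [coeff, toPoly_t_pow, coeff_X_pow]

theorem coeff_t (n : ℕ) : coeff (t δ) n = if n = 1 then 1 else 0 := by
  simpa using coeff_t_pow (δ := δ) 1 n

theorem toPoly_const_mul_t_pow (a : D) (k : ℕ) :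
    toPoly (const δ a * t δ ^ k) = monomial k a := by
  rw [toPoly_const_mul, toPoly_t_pow, C_mul_X_pow_eq_monomial]

@[elab_as_elim]
theorem induction_on {P : DiffPoly δ → Prop} (g : DiffPoly δ)
    (add : ∀ g h, P g → P h → P (g + h)) (mono : ∀ a k, P (const δ a * t δ ^ k)) : P g :=
  Polynomial.induction_on' (motive := fun q : D[X] => P (toPoly.symm q)) (toPoly g)
    (fun q r hq hr => add _ _ hq hr) fun k a => by
      rw [← toPoly_const_mul_t_pow, AddEquiv.symm_apply_apply]
      exact mono a k

theorem const_injective : Function.Injective (const δ) := fun _ _ h => Polynomial.C_injective h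

theorem degree_lt_iff {g : DiffPoly δ} {m : ℕ} :
    degree g < (m : WithBot ℕ) ↔ ∀ n, m ≤ n → coeff g n = 0 :=
  Polynomial.degree_lt_iff_coeff_zero _ _

/-! ### Powers of linear polynomials -/

theorem coeff_linear_pow (a : D) (k : ℕ) :
    coeff ((t δ + const δ a) ^ k) k = 1 ∧ ∀ n, k < n → coeff ((t δ + const δ a) ^ k) n = 0 := by
  induction k with
  | zero => simp +contextual [coeff_one, Nat.pos_iff_ne_zero]
  | succ k ih =>
    simp only [pow_succ', add_mul]
    refine ⟨by simp [ih.1, ih.2 (k + 1) (by omega)], fun n hn => ?_⟩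
    obtain ⟨n, rfl⟩ : ∃ m, n = m + 1 := ⟨n - 1, by omega⟩
    simp [ih.2 n (by omega), ih.2 (n + 1) (by omega)]

theorem coeff_linear_pow_succ (a : D) (k : ℕ) :
    coeff ((t δ + const δ a) ^ (k + 1)) k = (k + 1) * a := by
  induction k with
  | zero => simp [coeff_t, coeff_const]
  | succ k ih =>
    rw [pow_succ', add_mul, coeff_add, coeff_t_mul_succ, ih, coeff_const_mul,
      (coeff_linear_pow a (k + 1)).1, δ.map_one]
    push_cast
    simp [add_mul]

/-- Coefficientwise form of d/dt (t + a)^(k+1) = (k+1)(t + a)^k: formal differentiation in t is a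
derivation of D[t;δ], and t + a commutes with its derivative 1. -/
theorem derivative_linear_pow (a : D) (k : ℕ) (n : ℕ) :
    coeff ((t δ + const δ a) ^ (k + 1)) (n + 1) * (n + 1) =
      (k + 1) * coeff ((t δ + const δ a) ^ k) n := by
  have hδ : ∀ (b : D) (m : ℕ), δ (b * (m + 1)) = δ b * (m + 1) := by
    intro b m
    have h : ∀ j : ℕ, δ (j : D) = 0 := by
      intro j
      induction j with
      | zero => simp
      | succ j ih => rw [Nat.cast_succ, map_add, ih, δ.map_one, add_zero]
    have := h (m + 1)
    push_cast at this
    rw [δ.leibniz, this, mul_zero, zero_add]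
  induction k generalizing n with
  | zero =>
    simp only [zero_add, pow_one, pow_zero, coeff_add, coeff_t, coeff_const, coeff_one]
    cases n <;> simp
  | succ k ih =>
    have e : ∀ m, coeff ((t δ + const δ a) ^ (k + 1 + 1)) (m + 1) =
        coeff ((t δ + const δ a) ^ (k + 1)) m + δ (coeff ((t δ + const δ a) ^ (k + 1)) (m + 1)) +
        a * coeff ((t δ + const δ a) ^ (k + 1)) (m + 1) := by
      intro m
      rw [pow_succ', add_mul, coeff_add, coeff_t_mul_succ, coeff_const_mul]
    have hδ' : ∀ b : D, δ ((k + 1) * b) = (k + 1) * δ b := by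
      intro b
      rw [← Nat.cast_succ, Nat.cast_comm, Nat.cast_succ, hδ, ← Nat.cast_succ, Nat.cast_comm]
    rw [e, add_mul, add_mul, ← hδ, ih, hδ', mul_assoc, ih]
    have hk : ∀ b : D, a * ((k + 1) * b) = (k + 1) * (a * b) := by
      intro b
      rw [← Nat.cast_succ, ← mul_assoc, ← Nat.cast_comm, mul_assoc]
    rw [hk]
    cases n with
    | zero =>
      have h0 : coeff ((t δ + const δ a) ^ (k + 1)) 0 =
          δ (coeff ((t δ + const δ a) ^ k) 0) + a * coeff ((t δ + const δ a) ^ k) 0 := by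
        rw [pow_succ', add_mul, coeff_add, coeff_t_mul_zero, coeff_const_mul]
      rw [h0]
      push_cast
      noncomm_ring
    | succ n =>
      have h1 : coeff ((t δ + const δ a) ^ (k + 1)) (n + 1) =
          coeff ((t δ + const δ a) ^ k) n + δ (coeff ((t δ + const δ a) ^ k) (n + 1)) +
          a * coeff ((t δ + const δ a) ^ k) (n + 1) := by
        rw [pow_succ', add_mul, coeff_add, coeff_t_mul_succ, coeff_const_mul]
      have h2 := ih n
      -- Splitting n + 2 as (n + 1) + 1 lets the induction hypothesis be used a second time; the
      -- leftover copy raises the factor k + 1 to k + 2.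
      have h3 : coeff ((t δ + const δ a) ^ (k + 1)) (n + 1) * ((n + 1 : ℕ) + 1) =
          (k + 1) * coeff ((t δ + const δ a) ^ k) n +
            coeff ((t δ + const δ a) ^ (k + 1)) (n + 1) := by
        rw [mul_add, mul_one, Nat.cast_succ, h2]
      rw [h3, h1]
      push_cast
      noncomm_ring

/-- `(t - b) ^ p = t ^ p - V_p(b)` in characteristic `p`. -/
theorem linear_pow_char (p : ℕ) [hp : Fact p.Prime] [CharP D p] (b : D) :
    (t δ - const δ b) ^ p = t δ ^ p - const δ (V δ p b) := by
  have hb : t δ - const δ b = t δ + const δ (-b) := by rw [map_neg, sub_eq_add_neg]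
  have hV : V δ p b = coeff (t δ ^ p - (t δ - const δ b) ^ p) 0 := rfl
  apply ext_coeff
  intro n
  rcases n with _ | n
  · simp [hV, coeff_const]
  · rw [coeff_sub, coeff_t_pow, coeff_const, if_neg n.succ_ne_zero, sub_zero, hb]
    rcases lt_trichotomy (n + 1) p with h | h | h
    · rw [if_neg h.ne]
      -- For the exponent p the right side carries the factor p = 0, while n + 1 < p is invertible
      -- in D, so the intermediate coefficients vanish.
      have := derivative_linear_pow (δ := δ) (-b) (p - 1) n
      rw [Nat.sub_add_cancel hp.out.one_le, ← Nat.cast_add_one, ← Nat.cast_add_one,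
        Nat.sub_add_cancel hp.out.one_le, CharP.cast_eq_zero D p, zero_mul] at this
      refine (mul_eq_zero.mp this).resolve_right fun h0 => ?_
      rw [CharP.cast_eq_zero_iff D p] at h0
      exact absurd (Nat.le_of_dvd n.succ_pos h0) (by omega)
    · rw [if_pos h, h, (coeff_linear_pow _ _).1]
    · rw [if_neg h.ne', (coeff_linear_pow _ _).2 _ h]

/-! ### `t ^ p` and constants -/

/-- `t ^ p a = a t ^ p + δ ^ p (a)` in characteristic `p`. -/
theorem t_pow_char_mul_const (p : ℕ) [hp : Fact p.Prime] [CharP (DiffPoly δ) p] (a : D) :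
    t δ ^ p * const δ a = const δ a * t δ ^ p + const δ (δ^[p] a) := by
  -- The inner derivation ad t = L_t - R_t restricts to δ on the constants.
  have hA : ∀ k : ℕ, ((LinearMap.mulLeft ℤ (t δ) - LinearMap.mulRight ℤ (t δ)) ^ k) (const δ a) =
      const δ (δ^[k] a) := by
    intro k
    induction k with
    | zero => simp
    | succ k ih =>
      rw [pow_succ', Module.End.mul_apply, ih, Function.iterate_succ_apply', LinearMap.sub_apply,
        LinearMap.mulLeft_apply, LinearMap.mulRight_apply, t_mul_const, add_sub_cancel_left]
  have : CharP (Module.End ℤ (DiffPoly δ)) p := by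
    refine ⟨fun x => ⟨fun h => ?_, fun h => ?_⟩⟩
    · rw [← CharP.cast_eq_zero_iff (DiffPoly δ) p]
      simpa [nsmul_eq_mul] using DFunLike.congr_fun h (1 : DiffPoly δ)
    · ext y
      simp [nsmul_eq_mul, (CharP.cast_eq_zero_iff (DiffPoly δ) p x).mpr h]
  -- L_t and R_t commute in an endomorphism ring of characteristic p, so (ad t)^p = L_t^p - R_t^p =
  -- ad(t^p).
  have h := DFunLike.congr_fun
    (sub_pow_char_of_commute p (LinearMap.commute_mulLeft_right (R := ℤ) (t δ) (t δ))) (const δ a)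
  rw [hA, LinearMap.pow_mulLeft, LinearMap.pow_mulRight, LinearMap.sub_apply,
    LinearMap.mulLeft_apply, LinearMap.mulRight_apply] at h
  rw [h]
  abel

theorem charP_diffPoly (δ : RingDerivation D) (p : ℕ) [CharP D p] : CharP (DiffPoly δ) p :=
  charP_of_injective_ringHom const_injective p

/-! ### The substitutions `t ↦ t + a` -/

theorem G_add (a : D) (g h : DiffPoly δ) :
    G δ (RingEquiv.refl D) a (g + h) = G δ (RingEquiv.refl D) a g + G δ (RingEquiv.refl D) a h := by
  unfold G
  rw [map_add, Polynomial.sum_add_index] <;> simp [add_mul]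

theorem G_monomial (a b : D) (k : ℕ) :
    G δ (RingEquiv.refl D) a (const δ b * t δ ^ k) = const δ b * (t δ + const δ a) ^ k := by
  unfold G
  rw [toPoly_const_mul_t_pow, Polynomial.sum_monomial_index] <;> simp

theorem G_const_mul (a b : D) (g : DiffPoly δ) :
    G δ (RingEquiv.refl D) a (const δ b * g) = const δ b * G δ (RingEquiv.refl D) a g := by
  induction g using induction_on with
  | add g h hg hh => rw [mul_add, G_add, hg, hh, G_add, mul_add]
  | mono c k => rw [← mul_assoc, ← map_mul, G_monomial, G_monomial, map_mul, mul_assoc]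

/-- For central a, the element t + a obeys the same commutation rule with constants as t does. The
value of δ(a) plays no role. -/
theorem G_t_mul {a : D} (ha : ∀ b, a * b = b * a) (g : DiffPoly δ) :
    G δ (RingEquiv.refl D) a (t δ * g) = (t δ + const δ a) * G δ (RingEquiv.refl D) a g := by
  induction g using induction_on with
  | add g h hg hh => rw [mul_add, G_add, hg, hh, G_add, mul_add]
  | mono c k =>
    rw [← mul_assoc, t_mul_const, add_mul, mul_assoc, ← pow_succ', G_add, G_monomial, G_monomial,
      G_monomial, ← mul_assoc, add_mul, t_mul_const, ← map_mul (const δ) a, ha, map_mul, pow_succ']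
    noncomm_ring

/-- `G_{id,a}` as a ring homomorphism, for `a` in the centre of `D`. -/
def shift (δ : RingDerivation D) (a : D) (ha : ∀ b, a * b = b * a) :
    DiffPoly δ →+* DiffPoly δ where
  toFun := G δ (RingEquiv.refl D) a
  map_zero' := by simp [G]
  map_one' := by simpa using G_monomial (δ := δ) a 1 0
  map_add' := G_add a
  map_mul' g h := by
    induction g using induction_on with
    | add g g' hg hg' => rw [add_mul, G_add, hg, hg', G_add, add_mul]
    | mono b k =>
      rw [mul_assoc, G_const_mul, G_monomial, mul_assoc]
      congr 1
      induction k with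
      | zero => simp
      | succ k ih => rw [pow_succ', mul_assoc, G_t_mul ha, ih, pow_succ', mul_assoc]

variable {a : D} {ha : ∀ b, a * b = b * a}

theorem shift_apply (g : DiffPoly δ) : shift δ a ha g = G δ (RingEquiv.refl D) a g := rfl

@[simp] theorem shift_const (b : D) : shift δ a ha (const δ b) = const δ b := by
  simpa [shift_apply] using G_monomial (δ := δ) a b 0

@[simp] theorem shift_t : shift δ a ha (t δ) = t δ + const δ a := by
  simpa [shift_apply] using G_monomial (δ := δ) a 1 1

theorem ringHom_ext {S : Type*} [Ring S] {φ ψ : DiffPoly δ →+* S}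
    (hc : ∀ b, φ (const δ b) = ψ (const δ b)) (ht : φ (t δ) = ψ (t δ)) : φ = ψ := by
  ext g
  induction g using induction_on with
  | add g h hg hh => rw [map_add, map_add, hg, hh]
  | mono b k => rw [map_mul, map_mul, map_pow, map_pow, hc, ht]

theorem coeff_shift (g : DiffPoly δ) (n : ℕ) :
    coeff (shift δ a ha g) n =
      (toPoly g).sum fun i b => b * coeff ((t δ + const δ a) ^ i) n := by
  rw [shift_apply, G, Polynomial.sum_def, Polynomial.sum_def, coeff, map_sum, finsetSum_coeff]
  exact Finset.sum_congr rfl fun i _ => coeff_const_mul _ _ _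

theorem coeff_shift_eq_zero {g : DiffPoly δ} {m : ℕ} (hg : ∀ n, m ≤ n → coeff g n = 0) (n : ℕ)
    (hn : m ≤ n) : coeff (shift δ a ha g) n = 0 := by
  rw [coeff_shift, Polynomial.sum_def]
  refine Finset.sum_eq_zero fun i hi => ?_
  have : i < m := by
    by_contra h
    exact mem_support_iff.mp hi (hg i (not_lt.mp h))
  rw [(coeff_linear_pow a i).2 n (by omega), mul_zero]

theorem degree_shift_lt {g : DiffPoly δ} {m : ℕ} (hg : degree g < (m : WithBot ℕ)) :
    degree (shift δ a ha g) < (m : WithBot ℕ) :=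
  degree_lt_iff.mpr (coeff_shift_eq_zero (degree_lt_iff.mp hg))

/-- If `deg g ≤ m`, then `G_{id,a}` does not change the coefficient of `t ^ m`. -/
theorem coeff_shift_top {g : DiffPoly δ} {m : ℕ} (hg : ∀ n, m < n → coeff g n = 0) :
    coeff (shift δ a ha g) m = coeff g m := by
  rw [coeff_shift, Polynomial.sum_over_range' _ (by simp) (m + 1), Finset.sum_range_succ,
    (coeff_linear_pow a m).1, mul_one, Finset.sum_eq_zero, zero_add, coeff]
  · intro i hi
    rw [(coeff_linear_pow a i).2 m (Finset.mem_range.mp hi), mul_zero]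
  · exact Nat.lt_succ_of_le (natDegree_le_iff_coeff_eq_zero.mpr hg)

theorem coeff_shift_subtop {g : DiffPoly δ} {m : ℕ} (hg : ∀ n, m + 1 < n → coeff g n = 0) :
    coeff (shift δ a ha g) m = coeff g m + coeff g (m + 1) * ((m + 1) * a) := by
  rw [coeff_shift, Polynomial.sum_over_range' _ (by simp) (m + 2), Finset.sum_range_succ,
    Finset.sum_range_succ, (coeff_linear_pow a m).1, mul_one, coeff_linear_pow_succ,
    Finset.sum_eq_zero, zero_add, coeff, coeff]
  · intro i hi
    rw [(coeff_linear_pow a i).2 m (Finset.mem_range.mp hi), mul_zero]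
  · exact Nat.lt_succ_of_le (natDegree_le_iff_coeff_eq_zero.mpr hg)

end DiffPoly

open DiffPoly

/-! ### Residue classes modulo Rf -/

namespace Petit

variable {D : Type u} [DivisionRing D] {δ : RingDerivation D} {f : DiffPoly δ} {hf : f.Monic}

theorem mk_add (g h : DiffPoly δ) : (mk (g + h) : Petit f hf) = mk g + mk h :=
  val_injective (by rw [map_add, val_mk, val_mk, val_mk, modR_add])

theorem mk_val (x : Petit f hf) : mk x.val = x :=
  val_injective (by rw [val_mk, modR_self hf (degree_val x)])

theorem val_mk_of_degree_lt {g : DiffPoly δ} (hg : DiffPoly.degree g < (DiffPoly.natDegree f : WithBot ℕ)) :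
    (mk g : Petit f hf).val = g := modR_self hf hg

theorem mk_mul_self (q : DiffPoly δ) : (mk (q * f) : Petit f hf) = 0 :=
  val_injective (by
    rw [val_mk, map_zero]
    exact modR_eq hf (q := q) (lowDegree δ (DiffPoly.natDegree f)).zero_mem (by rw [add_zero]))

theorem mk_zero : (mk 0 : Petit f hf) = 0 := by
  rw [← mk_mul_self 0, zero_mul]

theorem mk_eq_zero_iff {g : DiffPoly δ} : (mk g : Petit f hf) = 0 ↔ ∃ q, g = q * f := by
  refine ⟨fun h => ?_, ?_⟩
  · obtain ⟨q, hq⟩ := exists_modR hf g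
    refine ⟨q, ?_⟩
    have h' : modR hf g = 0 := by rw [← val_mk (hf := hf), h, map_zero]
    rwa [h', add_zero] at hq
  · rintro ⟨q, rfl⟩
    exact mk_mul_self q

theorem mk_neg (g : DiffPoly δ) : (mk (-g) : Petit f hf) = -mk g := by
  rw [eq_neg_iff_add_eq_zero, ← mk_add, neg_add_cancel, mk_zero]

theorem mk_sub (g h : DiffPoly δ) : (mk (g - h) : Petit f hf) = mk g - mk h := by
  rw [sub_eq_add_neg, mk_add, mk_neg, sub_eq_add_neg]

/-- Rf is a left ideal, so a right factor may be reduced first. A left factor in general may not;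
this is where associativity can fail. -/
theorem mk_mul_val_mk (g h : DiffPoly δ) :
    (mk (g * (mk h : Petit f hf).val) : Petit f hf) = mk (g * h) := by
  obtain ⟨q, hq⟩ := exists_modR hf h
  conv_rhs => rw [hq, mul_add, mk_add, ← mul_assoc, mk_mul_self, zero_add]
  rw [val_mk]

theorem mul_def (x y : Petit f hf) : x * y = mk (x.val * y.val) := rfl

theorem mk_one : (mk 1 : Petit f hf) = 1 := rfl

/-! ### The left `D`-space `S_f` -/

instance : SMul D (Petit f hf) := ⟨fun a x => mk (const δ a * x.val)⟩

theorem val_const_smul (a : D) (x : Petit f hf) : (a • x).val = const δ a * x.val := by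
  change modR hf _ = _
  rw [modR_const_mul, modR_self hf (degree_val x)]

instance : Module D (Petit f hf) where
  one_smul x := val_injective (by simp [val_const_smul])
  mul_smul a b x := val_injective (by simp [val_const_smul, mul_assoc])
  smul_zero a := val_injective (by simp [val_const_smul])
  smul_add a x y := val_injective (by simp [val_const_smul, mul_add])
  add_smul a b x := val_injective (by simp [val_const_smul, add_mul])
  zero_smul x := val_injective (by simp [val_const_smul])

theorem smul_mk (a : D) (g : DiffPoly δ) : a • (mk g : Petit f hf) = mk (const δ a * g) :=
  val_injective (by rw [val_const_smul, val_mk, val_mk, modR_const_mul])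

theorem smul_mul (a : D) (x y : Petit f hf) : a • x * y = a • (x * y) := by
  rw [mul_def, val_const_smul, mul_def, smul_mk, mul_assoc]

/-- The coefficients of an element of `S_f`. -/
def coeffs : Petit f hf ≃ₗ[D] (Fin (DiffPoly.natDegree f) → D) where
  toFun x i := DiffPoly.coeff x.val i
  map_add' x y := by ext i; simp
  map_smul' a x := by ext i; simp [val_const_smul]
  invFun c := mk (∑ i, const δ (c i) * t δ ^ (i : ℕ))
  left_inv x := by
    have hx := degree_lt_iff.mp (degree_val x)
    refine Eq.trans (congrArg mk ?_) (mk_val x)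
    refine ext_coeff fun n => ?_
    simp only [DiffPoly.coeff] at hx ⊢
    rw [map_sum, finsetSum_coeff]
    simp only [toPoly_const_mul_t_pow, coeff_monomial]
    by_cases hn : n < DiffPoly.natDegree f
    · rw [Finset.sum_eq_single ⟨n, hn⟩] <;> simp +contextual [Fin.ext_iff]
    · rw [hx n (by omega)]
      exact Finset.sum_eq_zero fun i _ => if_neg (by omega)
  right_inv c := by
    ext j
    have key : ∀ n, DiffPoly.coeff (∑ i, const δ (c i) * t δ ^ (i : ℕ)) n =
        ∑ i : Fin (DiffPoly.natDegree f), if (i : ℕ) = n then c i else 0 := by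
      intro n
      simp only [DiffPoly.coeff, map_sum, finsetSum_coeff, toPoly_const_mul_t_pow, coeff_monomial]
    dsimp only
    rw [val_mk_of_degree_lt, key]
    · simp [← Fin.ext_iff]
    · rw [degree_lt_iff]
      intro n hn
      rw [key]
      exact Finset.sum_eq_zero fun i _ => if_neg (by omega)

instance : FiniteDimensional D (Petit f hf) := LinearEquiv.finiteDimensional coeffs.symm

theorem finrank_eq_natDegree : Module.finrank D (Petit f hf) = DiffPoly.natDegree f := by
  rw [LinearEquiv.finrank_eq coeffs, Module.finrank_fin_fun]

instance {C : Type v} [Field C] [Algebra C D] :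
    IsScalarTower (constants C δ) D (Petit f hf) where
  smul_assoc c a x := val_injective (by
    rw [val_const_smul, val_smul, val_const_smul, Subfield.smul_def, Algebra.smul_def, map_mul,
      mul_assoc])

/-! ### `R`-submodules of `R/Rf` -/

/-- The `D`-subspaces of `R/Rf` that are submodules over `R = D[t;δ]`. -/
def IsStable (W : Submodule D (Petit f hf)) : Prop :=
  ∀ (g : DiffPoly δ), ∀ x ∈ W, mk (g * x.val) ∈ W

theorem isStable_top : IsStable (⊤ : Submodule D (Petit f hf)) := fun _ _ _ => trivial

theorem IsStable.inf {U W : Submodule D (Petit f hf)} (hU : IsStable U) (hW : IsStable W) :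
    IsStable (U ⊓ W) := fun g x hx => ⟨hU g x hx.1, hW g x hx.2⟩

theorem IsStable.sup {U W : Submodule D (Petit f hf)} (hU : IsStable U) (hW : IsStable W) :
    IsStable (U ⊔ W) := by
  intro g x hx
  obtain ⟨y, hy, z, hz, rfl⟩ := Submodule.mem_sup.mp hx
  rw [map_add, mul_add, mk_add]
  exact Submodule.add_mem_sup (hU g y hy) (hW g z hz)

theorem IsStable.sInf {𝒮 : Set (Submodule D (Petit f hf))} (h𝒮 : ∀ W ∈ 𝒮, IsStable W) :
    IsStable (sInf 𝒮) := by
  intro g x hx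
  rw [Submodule.mem_sInf] at hx ⊢
  exact fun W hW => h𝒮 W hW g x (hx W hW)

/-- The class of 1 generates R/Rf as a left R-module. -/
theorem IsStable.eq_top {W : Submodule D (Petit f hf)} (hW : IsStable W) (h : 1 ∈ W) : W = ⊤ := by
  rw [eq_top_iff]
  intro x _
  have := hW x.val 1 h
  rwa [← mk_one, mk_mul_val_mk, mul_one, mk_val] at this

/-- Right multiplication by `y` as a `D`-linear map. -/
def mulRight (y : Petit f hf) : Petit f hf →ₗ[D] Petit f hf where
  toFun x := x * y
  map_add' _ _ := add_mul _ _ _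
  map_smul' a x := smul_mul a x y

theorem exists_monic_of_ne_zero {x : Petit f hf} (hx : x ≠ 0) :
    ∃ a : D, a ≠ 0 ∧ (a • x).val.Monic ∧
      DiffPoly.natDegree (a • x).val = DiffPoly.natDegree x.val ∧ DiffPoly.natDegree x.val < DiffPoly.natDegree f := by
  have hx' : toPoly x.val ≠ 0 := fun h => hx (val_injective (toPoly.injective (by simpa using h)))
  have ha : (toPoly x.val).leadingCoeff ≠ 0 := leadingCoeff_ne_zero.mpr hx'
  have hP : toPoly ((toPoly x.val).leadingCoeff⁻¹ • x).val =
      Polynomial.C (toPoly x.val).leadingCoeff⁻¹ * toPoly x.val := by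
    rw [val_const_smul, toPoly_const_mul]
  refine ⟨_, inv_ne_zero ha, ?_, ?_, ?_⟩
  · rw [DiffPoly.Monic, hP, Polynomial.Monic, leadingCoeff_mul, leadingCoeff_C, inv_mul_cancel₀ ha]
  · rw [DiffPoly.natDegree, hP, natDegree_C_mul (inv_ne_zero ha), DiffPoly.natDegree]
  · have := degree_val x
    rw [DiffPoly.degree, degree_eq_natDegree hx'] at this
    exact_mod_cast this

/-- If `R/Rf` is simple, then `S_f` has no zero divisors. -/
theorem eq_zero_of_mul_eq_zero
    (hs : ∀ W : Submodule D (Petit f hf), IsStable W → W = ⊥ ∨ W = ⊤)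
    {x y : Petit f hf} (h : x * y = 0) (hy : y ≠ 0) : x = 0 := by
  by_contra hx
  obtain ⟨a, ha, hm, hd, hlt⟩ := exists_monic_of_ne_zero hx
  -- Divide g on the right by the monic multiple of x. Since xy ∈ Rf, only the remainder acts on y,
  -- and its degree is small enough for it to represent an element of S_f. Thus the range of right
  -- multiplication by y is the submodule Ry.
  have key : ∀ g : DiffPoly δ, mk (g * y.val) ∈ LinearMap.range (mulRight y) := by
    intro g
    obtain ⟨r, hr, q, rfl⟩ := exists_rem hm g
    refine ⟨mk r, ?_⟩
    change mk _ * y = _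
    rw [add_mul, mk_add, mul_assoc, ← mk_mul_val_mk q, ← mul_def, smul_mul, h, smul_zero, map_zero,
      mul_zero, mk_zero, zero_add, mul_def, val_mk_of_degree_lt]
    refine hr.trans ?_
    rw [hd]
    exact_mod_cast hlt
  have hW : IsStable (LinearMap.range (mulRight y)) := by
    rintro g _ ⟨z, rfl⟩
    change mk (g * (mk (z.val * y.val)).val) ∈ _
    rw [mk_mul_val_mk, ← mul_assoc]
    exact key _
  have htop : LinearMap.range (mulRight y) = ⊤ := by
    refine (hs _ hW).resolve_left fun h0 => hy ?_
    have := key 1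
    rwa [one_mul, mk_val, h0, Submodule.mem_bot] at this
  -- By simplicity Ry is everything; a surjective D-linear endomorphism of a finite-dimensional
  -- space is injective.
  have hinj := LinearMap.injective_iff_surjective.mpr (LinearMap.range_eq_top.mp htop)
  exact hx (hinj (by rw [map_zero]; exact h))

/-! ### The action of the substitutions on R/Rf -/

/-- If `G_{id,a}` fixes `f`, then it commutes with reduction modulo `f`. -/
theorem modR_shift {a : D} {ha : ∀ b, a * b = b * a} (h : shift δ a ha f = f) (g : DiffPoly δ) :
    modR hf (shift δ a ha g) = shift δ a ha (modR hf g) := by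
  obtain ⟨q, hq⟩ := exists_modR hf g
  refine modR_eq hf (q := shift δ a ha q) (degree_shift_lt (modR_degree hf g)) ?_
  conv_lhs => rw [hq, map_add, map_mul, h]

/-- The `D`-linear map of `S_f` induced by `G_{id,a}`. -/
def shift (f : DiffPoly δ) (hf : f.Monic) (a : D) (ha : ∀ b, a * b = b * a) :
    Petit f hf →ₗ[D] Petit f hf where
  toFun x := mk (DiffPoly.shift δ a ha x.val)
  map_add' x y := by rw [map_add, map_add, mk_add]
  map_smul' b x := by
    rw [val_const_smul, map_mul, shift_const, RingHom.id_apply, smul_mk]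

variable {a : D} {ha : ∀ b, a * b = b * a}

theorem val_shift (x : Petit f hf) : (shift f hf a ha x).val = DiffPoly.shift δ a ha x.val :=
  val_mk_of_degree_lt (degree_shift_lt (degree_val x))

theorem shift_mk (h : DiffPoly.shift δ a ha f = f) (g : DiffPoly δ) :
    shift f hf a ha (mk g) = mk (DiffPoly.shift δ a ha g) :=
  val_injective (by rw [val_shift, val_mk, val_mk, modR_shift h])

theorem shift_mul (h : DiffPoly.shift δ a ha f = f) (x y : Petit f hf) :
    shift f hf a ha (x * y) = shift f hf a ha x * shift f hf a ha y := by
  rw [mul_def, shift_mk h, map_mul, mul_def, val_shift, val_shift]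

end Petit


/-! ### A lattice argument on codimensions -/

/-- Let `P` define a family of subspaces closed under `⊓`, `⊔`, arbitrary meets and preimages under
a linear automorphism that has no invariant members except `⊥` and `⊤`. Then the codimension of a member of
maximal dimension among the proper ones divides the dimension of the space. -/
theorem codim_dvd_finrank {D M : Type*} [DivisionRing D] [AddCommGroup M] [Module D M]
    [FiniteDimensional D M] (P : Submodule D M → Prop) (htop : P ⊤)
    (hinf : ∀ U W, P U → P W → P (U ⊓ W)) (hsup : ∀ U W, P U → P W → P (U ⊔ W))
    (hsInf : ∀ 𝒮 : Set (Submodule D M), (∀ W ∈ 𝒮, P W) → P (sInf 𝒮))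
    (φ : M ≃ₗ[D] M) (hφ : ∀ W, P W → P (W.comap φ.toLinearMap))
    (hinv : ∀ W, P W → (∀ x ∈ W, φ x ∈ W) → W ≠ ⊤ → W = ⊥)
    {N : Submodule D M} (hN : P N) (hN' : N ≠ ⊤)
    (hmax : ∀ W, P W → W ≠ ⊤ → Module.finrank D W ≤ Module.finrank D N) :
    Module.finrank D M - Module.finrank D N ∣ Module.finrank D M := by
  have hlt : Module.finrank D N < Module.finrank D M := Submodule.finrank_lt hN'
  -- U has least dimension among the members whose codimension is a multiple of that of N. The goal
  -- is U = 0.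
  obtain ⟨U, ⟨hU, hUd⟩, hUmin⟩ := WellFounded.has_min
    (measure fun U : Submodule D M => Module.finrank D U).wf
    {U | P U ∧ Module.finrank D M - Module.finrank D N ∣ Module.finrank D M - Module.finrank D U}
    ⟨⊤, htop, by simp⟩
  let 𝒮 : Set (Submodule D M) := {W | P W ∧ Module.finrank D W = Module.finrank D N}
  have hne : ∀ W ∈ 𝒮, W ≠ ⊤ := by
    rintro W ⟨-, hW⟩ rfl
    rw [finrank_top] at hW
    omega
  have hle : U ≤ sInf 𝒮 := by
    refine le_sInf fun W hW => ?_
    by_contra hUW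
    -- U ⊔ W is strictly larger than W, so maximality makes it the whole space. Then U ⊓ W has
    -- codimension larger by exactly one more multiple, contradicting the choice of U.
    have hsup' : U ⊔ W = ⊤ := by
      by_contra hT
      have h1 := hmax _ (hsup U W hU hW.1) hT
      have h2 : W < U ⊔ W := lt_of_le_of_ne le_sup_right fun h => hUW (h ▸ le_sup_left)
      have h3 := Submodule.finrank_lt_finrank_of_lt h2
      have h4 := hW.2
      omega
    have h1 := Submodule.finrank_sup_add_finrank_inf_eq U W
    rw [hsup', finrank_top, hW.2] at h1
    have h2 : Module.finrank D U ≤ Module.finrank D M := Submodule.finrank_le U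
    refine hUmin (U ⊓ W) ⟨hinf U W hU hW.1, ?_⟩ (by
      change Module.finrank D ↥(U ⊓ W) < Module.finrank D U
      omega)
    have h3 : Module.finrank D M - Module.finrank D ↥(U ⊓ W) =
        (Module.finrank D M - Module.finrank D U) +
          (Module.finrank D M - Module.finrank D N) := by omega
    rw [h3]
    exact dvd_add hUd dvd_rfl
  have hbot : sInf 𝒮 = ⊥ := by
    refine hinv _ (hsInf 𝒮 fun W hW => hW.1) (fun x hx => ?_) fun h =>
      hne N ⟨hN, rfl⟩ (top_le_iff.mp (h ▸ sInf_le ⟨hN, rfl⟩))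
    rw [Submodule.mem_sInf] at hx ⊢
    intro W hW
    -- Preimages under φ keep the dimension, so φ⁻¹(W) is again one of the subspaces being
    -- intersected.
    refine hx (W.comap φ.toLinearMap) ⟨hφ W hW.1, ?_⟩
    rw [← hW.2]
    exact LinearEquiv.finrank_eq (φ.ofSubmodule' W)
  have hU0 : U = ⊥ := le_bot_iff.mp (hbot ▸ hle)
  rwa [hU0, finrank_bot, Nat.sub_zero] at hUd

theorem neg_one_mul_comm {D : Type*} [Ring D] (b : D) : -1 * b = b * -1 := by simp

/-! ### Submodules under t ↦ t - 1: simplicity or codimension one -/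

namespace Petit

variable {D : Type u} [DivisionRing D] {δ : RingDerivation D} {f : DiffPoly δ} {hf : f.Monic}

/-- A discrete derivative l(t - 1) - l(t) lowers the degree by exactly one as long as that degree is
positive and below p. An invariant nonzero W thus contains a nonzero constant. -/
theorem IsStable.eq_top_of_shift_mem {p : ℕ} [CharP D p] (hp : DiffPoly.natDegree f ≤ p)
    {W : Submodule D (Petit f hf)} (hW : IsStable W) (h0 : W ≠ ⊥)
    (hs : ∀ x ∈ W, shift f hf (-1) neg_one_mul_comm x ∈ W) : W = ⊤ := by
  obtain ⟨x, ⟨hxW, hx⟩, hmin⟩ := WellFounded.has_min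
    (measure fun x : Petit f hf => DiffPoly.natDegree x.val).wf {x | x ∈ W ∧ x ≠ 0}
    ((Submodule.ne_bot_iff W).mp h0)
  obtain ⟨a, ha, hm, hd, hlt⟩ := exists_monic_of_ne_zero hx
  have hlW : a • x ∈ W := W.smul_mem a hxW
  generalize hl : a • x = l at *
  have hz : ∀ n, DiffPoly.natDegree l.val < n → DiffPoly.coeff l.val n = 0 := fun n hn =>
    coeff_eq_zero_of_natDegree_lt hn
  have hl1 : DiffPoly.coeff l.val (DiffPoly.natDegree l.val) = 1 := hm.coeff_natDegree
  rcases hk : DiffPoly.natDegree l.val with _ | k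
  · have h1 : l.val = 1 := by
      apply toPoly.injective
      rw [toPoly_one]
      exact hm.natDegree_eq_zero.mp hk
    have h2 : l = 1 := by rw [← mk_val l, h1, mk_one]
    exact hW.eq_top (h2 ▸ hlW)
  · exfalso
    rw [hk] at hz hl1
    have hy : ∀ n, DiffPoly.coeff (shift f hf (-1) neg_one_mul_comm l - l).val n =
        DiffPoly.coeff (DiffPoly.shift δ (-1) neg_one_mul_comm l.val) n -
          DiffPoly.coeff l.val n := by
      intro n
      rw [map_sub, DiffPoly.coeff_sub, val_shift]
    -- For l monic of degree k + 1 this coefficient is -(k + 1), nonzero in D because k + 1 < deg f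
    -- ≤ p.
    have hyk : DiffPoly.coeff (shift f hf (-1) neg_one_mul_comm l - l).val k ≠ 0 := by
      rw [hy, coeff_shift_subtop hz, hl1, add_sub_cancel_left, one_mul, mul_neg_one, neg_ne_zero,
        ← Nat.cast_add_one, Ne, CharP.cast_eq_zero_iff D p]
      exact fun h => absurd (Nat.le_of_dvd k.succ_pos h) (by omega)
    refine hmin (shift f hf (-1) neg_one_mul_comm l - l) ⟨W.sub_mem (hs l hlW) hlW, ?_⟩ ?_
    · intro h
      rw [h, map_zero, DiffPoly.coeff_zero] at hyk
      exact hyk rfl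
    · change DiffPoly.natDegree (shift f hf (-1) neg_one_mul_comm l - l).val <
        DiffPoly.natDegree x.val
      rw [← hd, hk, Nat.lt_succ_iff]
      refine natDegree_le_iff_coeff_eq_zero.mpr fun n hn => ?_
      rw [show Polynomial.coeff _ n = DiffPoly.coeff _ n from rfl, hy]
      rcases (Nat.succ_le_of_lt hn).eq_or_lt with h | h
      · rw [← h, coeff_shift_top hz, sub_self]
      · rw [hz n h, sub_zero, coeff_shift_eq_zero (m := k + 2) hz n h]

/-- The bijective `D`-linear map of `S_f` induced by `G_{id,a}`. -/
def shiftEquiv (f : DiffPoly δ) (hf : f.Monic) (a : D) (ha : ∀ b, a * b = b * a) :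
    Petit f hf ≃ₗ[D] Petit f hf :=
  LinearEquiv.ofLinearMap (shift f hf a ha) (shift f hf (-a) (by simp [ha]))
    (by
      ext x
      apply val_injective
      have : (DiffPoly.shift δ a ha).comp (DiffPoly.shift δ (-a) (by simp [ha])) =
          RingHom.id _ := ringHom_ext (by simp) (by simp)
      simpa [val_shift] using DFunLike.congr_fun this x.val)
    (by
      ext x
      apply val_injective
      have : (DiffPoly.shift δ (-a) (by simp [ha])).comp (DiffPoly.shift δ a ha) =
          RingHom.id _ := ringHom_ext (by simp) (by simp)
      simpa [val_shift] using DFunLike.congr_fun this x.val)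

theorem IsStable.comap_shift {a : D} {ha : ∀ b, a * b = b * a}
    (h : DiffPoly.shift δ a ha f = f) {W : Submodule D (Petit f hf)} (hW : IsStable W) :
    IsStable (W.comap (shift f hf a ha)) := by
  intro g x hx
  rw [Submodule.mem_comap] at hx ⊢
  rw [shift_mk h, map_mul, ← val_shift]
  exact hW _ _ hx

/-- A polynomial of prime degree `p = char D` fixed by `t ↦ t - 1` is irreducible or has a
submodule of codimension one. -/
theorem isStable_dichotomy {p : ℕ} [Fact p.Prime] [CharP D p] (hp : DiffPoly.natDegree f = p)
    (h : DiffPoly.shift δ (-1) neg_one_mul_comm f = f) :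
    (∀ W : Submodule D (Petit f hf), IsStable W → W = ⊥ ∨ W = ⊤) ∨
      ∃ W : Submodule D (Petit f hf), IsStable W ∧ W ≠ ⊤ ∧ Module.finrank D W + 1 = p := by
  have hfr : Module.finrank D (Petit f hf) = p := finrank_eq_natDegree.trans hp
  have hpp : p.Prime := Fact.out
  have hbot : IsStable (⊥ : Submodule D (Petit f hf)) := by
    rintro g _ rfl
    rw [map_zero, mul_zero, mk_zero]
    exact Submodule.zero_mem _
  have hne : (⊥ : Submodule D (Petit f hf)) ≠ ⊤ := by
    intro h0
    have := finrank_top D (Petit f hf)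
    rw [← h0, finrank_bot, hfr] at this
    exact hpp.ne_zero this.symm
  let s : Set ℕ := {k | ∃ W : Submodule D (Petit f hf), IsStable W ∧ W ≠ ⊤ ∧
    Module.finrank D W = k}
  have hs : BddAbove s := ⟨p, by
    rintro _ ⟨W, -, -, rfl⟩
    exact hfr ▸ Submodule.finrank_le W⟩
  obtain ⟨N, hN, hN', hNs⟩ : sSup s ∈ s := Nat.sSup_mem ⟨0, ⊥, hbot, hne, by simp⟩ hs
  have hmax : ∀ W : Submodule D (Petit f hf), IsStable W → W ≠ ⊤ →
      Module.finrank D W ≤ Module.finrank D N := fun W hW hW' => by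
    rw [hNs]
    exact le_csSup hs ⟨W, hW, hW', rfl⟩
  have hdvd := codim_dvd_finrank (P := IsStable) isStable_top (fun _ _ => IsStable.inf)
    (fun _ _ => IsStable.sup) (fun _ => IsStable.sInf)
    (shiftEquiv f hf (-1) neg_one_mul_comm)
    (fun W hW => IsStable.comap_shift h hW)
    (fun W hW hW' => not_imp_comm.mp fun h0 => hW.eq_top_of_shift_mem hp.le h0 hW') hN hN' hmax
  have hlt := Submodule.finrank_lt hN'
  rw [hfr] at hdvd hlt
  -- Codimension p means N = 0, and then maximality of N leaves no proper nonzero submodule.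
  rcases (Nat.dvd_prime hpp).mp hdvd with h1 | h1
  · exact Or.inr ⟨N, hN, hN', by omega⟩
  · refine Or.inl fun W hW => ?_
    by_cases hW' : W = ⊤
    · exact Or.inr hW'
    · refine Or.inl (Submodule.finrank_eq_zero.mp ?_)
      have := hmax W hW hW'
      omega

/-- A submodule of codimension one of `R/Rf` contains some `t - z`. -/
theorem IsStable.exists_linear_mem {W : Submodule D (Petit f hf)} (hW : IsStable W) (hW' : W ≠ ⊤)
    (hr : Module.finrank D W + 1 = Module.finrank D (Petit f hf)) :
    ∃ z : D, mk (t δ - const δ z) ∈ W := by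
  have h1 : (1 : Petit f hf) ∉ W := fun h => hW' (hW.eq_top h)
  -- As 1 ∉ W and W has codimension one, W and D·1 span everything; z is the D-coordinate of t
  -- modulo W.
  have hlt : W < W ⊔ Submodule.span D {1} :=
    lt_of_le_of_ne le_sup_left fun h =>
      h1 (h ▸ Submodule.mem_sup_right (Submodule.mem_span_singleton_self _))
  have htop : W ⊔ Submodule.span D {1} = ⊤ := by
    apply Submodule.eq_top_of_finrank_eq
    have h2 := Submodule.finrank_lt_finrank_of_lt hlt
    have h3 := Submodule.finrank_le (W ⊔ Submodule.span D {1})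
    omega
  obtain ⟨w, hw, y, hy, hwy⟩ := Submodule.mem_sup.mp
    (show (mk (t δ) : Petit f hf) ∈ W ⊔ Submodule.span D {1} from htop ▸ trivial)
  obtain ⟨z, rfl⟩ := Submodule.mem_span_singleton.mp hy
  refine ⟨z, ?_⟩
  rw [mk_sub, ← hwy, ← mk_one, smul_mk, mul_one, add_sub_cancel_right]
  exact hw

end Petit

/-! ### `f = t ^ p - t - d` -/

section

variable {D : Type u} [DivisionRing D] (δ : RingDerivation D) (p : ℕ) [Fact p.Prime] (d : D)

theorem natDegree_diffExt : DiffPoly.natDegree (t δ ^ p - t δ - const δ d) = p := by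
  have hp := (Fact.out : p.Prime).two_le
  have e : toPoly (t δ ^ p - t δ - const δ d) = X ^ p - (X + Polynomial.C d) := by
    rw [map_sub, map_sub, toPoly_t_pow, sub_sub]
    rfl
  rw [DiffPoly.natDegree, e, natDegree_sub_eq_left_of_natDegree_lt, natDegree_X_pow]
  rw [natDegree_X_add_C, natDegree_X_pow]
  omega

theorem shift_diffExt [CharP D p] :
    DiffPoly.shift δ (-1) neg_one_mul_comm (t δ ^ p - t δ - const δ d) =
      t δ ^ p - t δ - const δ d := by
  have := charP_diffPoly δ p
  rw [map_sub, map_sub, map_pow, shift_t, shift_const, map_neg, map_one, ← sub_eq_add_neg,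
    sub_pow_char_of_commute p (Commute.one_right _), one_pow]
  abel

/-- Right division of `t ^ p - t - d` by `t - z`. -/
theorem diffExt_eq [CharP D p] (z : D) :
    t δ ^ p - t δ - const δ d =
      ((t δ - const δ z) ^ (p - 1) - 1) * (t δ - const δ z) + const δ (V δ p z - z - d) := by
  rw [sub_mul, ← pow_succ, Nat.sub_add_cancel (Fact.out : p.Prime).one_le, linear_pow_char, one_mul,
    map_sub, map_sub]
  abel

/-- In the codimension-one case, t - z ∈ W. Multiplying it by its cofactor in `diffExt_eq` gives
-(V_p(z) - z - d) modulo Rf, a nonzero constant by hypothesis, so W would contain 1. -/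
theorem eq_zero_of_mul_eq_zero_of_forall_ne [CharP D p] (h : ∀ z, d ≠ V δ p z - z)
    {x y : GenDiffAlg δ p d} (hxy : x * y = 0) : x = 0 ∨ y = 0 := by
  rcases Petit.isStable_dichotomy (hf := monic_diffExt δ p d) (natDegree_diffExt δ p d)
    (shift_diffExt δ p d) with hs | ⟨W, hW, hW', hr⟩
  · exact or_iff_not_imp_right.mpr fun hy => Petit.eq_zero_of_mul_eq_zero hs hxy hy
  · exfalso
    obtain ⟨z, hz⟩ := hW.exists_linear_mem hW'
      (by rw [hr, Petit.finrank_eq_natDegree, natDegree_diffExt])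
    have h1 := hW ((t δ - const δ z) ^ (p - 1) - 1) _ hz
    rw [Petit.mk_mul_val_mk, eq_sub_of_add_eq (diffExt_eq δ p d z).symm, Petit.mk_sub] at h1
    have h0 := Petit.mk_mul_self (hf := monic_diffExt δ p d) 1
    rw [one_mul] at h0
    have h2 : ∀ a : D, (Petit.mk (const δ a) : GenDiffAlg δ p d) = a • 1 := fun a => by
      rw [← Petit.mk_one, Petit.smul_mk, mul_one]
    rw [h0, zero_sub, W.neg_mem_iff, h2] at h1
    have hc : V δ p z - z - d ≠ 0 := fun h' => h z (sub_eq_zero.mp h').symm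
    exact hW' (hW.eq_top ((W.smul_mem_iff hc).mp h1))

/-- The remainder in `diffExt_eq` vanishes, so f = ((t - z)^(p-1) - 1)(t - z), and both factors have
degree less than p. -/
theorem exists_mul_eq_zero [CharP D p] (z : D) (h : d = V δ p z - z) :
    ∃ x y : GenDiffAlg δ p d, x ≠ 0 ∧ y ≠ 0 ∧ x * y = 0 := by
  have hp := (Fact.out : p.Prime).two_le
  have hb : t δ - const δ z = t δ + const δ (-z) := by rw [map_neg, sub_eq_add_neg]
  have hmk : ∀ (g : DiffPoly δ) (k : ℕ), k < p → DiffPoly.coeff g k ≠ 0 →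
      (∀ n, k < n → DiffPoly.coeff g n = 0) →
      (Petit.mk g : GenDiffAlg δ p d).val = g ∧ (Petit.mk g : GenDiffAlg δ p d) ≠ 0 := by
    intro g k hk hg hg'
    have hv : (Petit.mk g : GenDiffAlg δ p d).val = g := by
      apply Petit.val_mk_of_degree_lt
      rw [natDegree_diffExt, degree_lt_iff]
      exact fun n hn => hg' n (by omega)
    refine ⟨hv, fun h0 => hg ?_⟩
    rw [← hv, h0, map_zero, DiffPoly.coeff_zero]
  -- Since p - 1 > 0, subtracting 1 leaves the leading coefficient 1 untouched.
  obtain ⟨hx1, hx2⟩ := hmk ((t δ - const δ z) ^ (p - 1) - 1) (p - 1) (by omega)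
    (by
      rw [hb, DiffPoly.coeff_sub, (coeff_linear_pow _ _).1, DiffPoly.coeff_one, if_neg (by omega)]
      simp)
    (fun n hn => by
      rw [hb, DiffPoly.coeff_sub, (coeff_linear_pow _ _).2 n hn, DiffPoly.coeff_one,
        if_neg (by omega), sub_zero])
  obtain ⟨hy1, hy2⟩ := hmk (t δ - const δ z) 1 (by omega)
    (by simp [coeff_t, coeff_const])
    (fun n hn => by
      rw [DiffPoly.coeff_sub, coeff_t, coeff_const, if_neg (by omega), if_neg (by omega), sub_zero])
  refine ⟨_, _, hx2, hy2, ?_⟩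
  rw [Petit.mul_def, hx1, hy1, eq_sub_of_add_eq (diffExt_eq δ p d z).symm, h, sub_self, map_zero,
    sub_zero, Petit.mk_eq_zero_iff]
  exact ⟨1, (one_mul _).symm⟩

end


/-! ### The dimension of `C` over `F` -/

/-- The images of 0, ..., p - 1 are p distinct roots, fixed by Frobenius, of a monic polynomial of
degree p. -/
theorem X_pow_char_sub_X_eq_prod (F : Type*) [Field F] (p : ℕ) [hp : Fact p.Prime] [CharP F p] :
    (X ^ p - X : F[X]) = ∏ i ∈ Finset.range p, (X - Polynomial.C (i : F)) := by
  have hd : (X ^ p - X : F[X]).natDegree = p :=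
    FiniteField.X_pow_card_sub_X_natDegree_eq F hp.out.one_lt
  have hm : (∏ i ∈ Finset.range p, (X - Polynomial.C (i : F))).Monic :=
    monic_prod_of_monic _ _ fun i _ => monic_X_sub_C _
  have hinj : ∀ i ∈ Finset.range p, ∀ j ∈ Finset.range p, (i : F) = j → i = j := fun i hi j hj h =>
    CharP.natCast_injOn_Iio F p (Finset.mem_range.mp hi) (Finset.mem_range.mp hj) h
  have hm' : (X ^ p - X : F[X]).Monic :=
    monic_X_pow_sub (by rw [degree_X]; exact_mod_cast hp.out.one_lt)
  refine Polynomial.eq_of_monic_of_dvd_of_natDegree_le hm hm' ?_ ?_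
  · refine Finset.prod_dvd_of_coprime (fun i hi j hj hij => ?_) fun i _ => ?_
    · exact isCoprime_X_sub_C_of_isUnit_sub
        (sub_ne_zero.mpr fun h => hij (hinj i hi j hj h)).isUnit
    · rw [dvd_iff_isRoot, IsRoot, eval_sub, eval_pow, eval_X, ← frobenius_def, map_natCast,
        sub_self]
  · rw [hd, natDegree_prod_of_monic _ _ fun i _ => monic_X_sub_C _]
    simp only [natDegree_X_sub_C, Finset.sum_const, Finset.card_range, smul_eq_mul, mul_one, le_refl]

section Centre

variable (C : Type v) [Field C] {D : Type u} [DivisionRing D] [Algebra C D]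
  [Algebra.IsCentral C D] (δ : RingDerivation D)

theorem restrictCentre_mul (a b : C) :
    restrictCentre C δ (a * b) = a * restrictCentre C δ b + restrictCentre C δ a * b := by
  apply (algebraMap C D).injective
  rw [algebraMap_restrictCentre, map_mul, δ.leibniz, map_add, map_mul, map_mul,
    algebraMap_restrictCentre, algebraMap_restrictCentre]

theorem restrictCentre_eq_zero_iff (c : C) : restrictCentre C δ c = 0 ↔ c ∈ constants C δ := by
  rw [mem_constants, ← algebraMap_restrictCentre,
    map_eq_zero_iff (algebraMap C D) (algebraMap C D).injective]

variable {C δ}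

theorem restrictCentre_pow {w : C} (hw : restrictCentre C δ w = w) (i : ℕ) :
    restrictCentre C δ (w ^ i) = (i : C) * w ^ i := by
  induction i with
  | zero =>
    rw [pow_zero, Nat.cast_zero, zero_mul, restrictCentre_eq_zero_iff]
    exact one_mem _
  | succ i ih =>
    rw [pow_succ, restrictCentre_mul, ih, hw]
    push_cast
    ring

/-- The cofactor (t^p - t)/(t - 1) has smaller degree than the minimal polynomial, so it does not
annihilate δ on C; any nonzero value of it is killed by δ - 1. -/
theorem exists_eigenvector (p : ℕ) [hp : Fact p.Prime]
    (hδ : minpoly (constants C δ) (restrictCentre C δ) = X ^ p - X) :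
    ∃ w : C, w ≠ 0 ∧ restrictCentre C δ w = w := by
  obtain ⟨q, hq⟩ : (X - Polynomial.C (1 : constants C δ)) ∣ X ^ p - X := by
    rw [dvd_iff_isRoot, IsRoot]
    simp
  have h0 : (X ^ p - X : (constants C δ)[X]) ≠ 0 :=
    FiniteField.X_pow_card_sub_X_ne_zero _ hp.out.one_lt
  have hq0 : q ≠ 0 := by
    rintro rfl
    exact h0 (by rw [hq, mul_zero])
  have hne : aeval (restrictCentre C δ) q ≠ 0 := by
    intro h
    have h1 := Polynomial.natDegree_le_of_dvd (minpoly.dvd _ _ h) hq0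
    rw [hδ, hq, (monic_X_sub_C _).natDegree_mul' hq0, natDegree_X_sub_C] at h1
    omega
  obtain ⟨x, hx⟩ : ∃ x, aeval (restrictCentre C δ) q x ≠ 0 := by
    by_contra! h
    exact hne (LinearMap.ext h)
  refine ⟨_, hx, ?_⟩
  have h1 := minpoly.aeval (constants C δ) (restrictCentre C δ)
  rw [hδ, hq] at h1
  have h2 := DFunLike.congr_fun h1 x
  rw [map_mul, Module.End.mul_apply] at h2
  simpa [sub_eq_zero] using h2

/-- `[C : F] = p`. -/
theorem finrank_constants (p : ℕ) [hp : Fact p.Prime] [CharP C p]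
    (hδ : minpoly (constants C δ) (restrictCentre C δ) = X ^ p - X) :
    Module.finrank (constants C δ) C = p := by
  obtain ⟨w, hw0, hw⟩ := exists_eigenvector p hδ
  have : CharP (constants C δ) p :=
    (RingHom.charP_iff (constants C δ).subtype (constants C δ).subtype.injective p).mpr ‹_›
  have hli : LinearIndependent (constants C δ) fun i : Fin p => w ^ (i : ℕ) := by
    refine Module.End.eigenvectors_linearIndependent' (restrictCentre C δ)
      (fun i : Fin p => ((i : ℕ) : constants C δ)) (fun i j h => ?_) _ fun i => ?_
    · exact Fin.ext (CharP.natCast_injOn_Iio (constants C δ) p i.2 j.2 h)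
    · refine ⟨Module.End.mem_eigenspace_iff.mpr ?_, pow_ne_zero _ hw0⟩
      rw [restrictCentre_pow hw, Subfield.smul_def]
      simp
  -- Dividing an eigenvector for i by w^i gives a constant of δ, so the eigenspace lies in F w^i.
  have hker : ∀ i < p, LinearMap.ker (aeval (restrictCentre C δ)
      (X - Polynomial.C ((i : ℕ) : constants C δ))) ≤
        Submodule.span (constants C δ) (Set.range fun i : Fin p => w ^ (i : ℕ)) := by
    intro i hi x hx
    have hx' : restrictCentre C δ x = (i : C) * x := by
      rw [LinearMap.mem_ker] at hx
      simpa [sub_eq_zero, Subfield.smul_def] using hx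
    have e : x = x * (w ^ i)⁻¹ * w ^ i := by rw [inv_mul_cancel_right₀ (pow_ne_zero _ hw0)]
    have hc : x * (w ^ i)⁻¹ ∈ constants C δ := by
      rw [← restrictCentre_eq_zero_iff]
      have h1 := restrictCentre_mul C δ (x * (w ^ i)⁻¹) (w ^ i)
      rw [← e, hx', restrictCentre_pow hw, mul_left_comm, ← e, left_eq_add] at h1
      exact (mul_eq_zero.mp h1).resolve_right (pow_ne_zero _ hw0)
    rw [e]
    exact Submodule.smul_mem _ (⟨_, hc⟩ : constants C δ)
      (Submodule.subset_span ⟨⟨i, hi⟩, rfl⟩)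
  -- The linear factors are pairwise coprime, so the kernel of their product is the sum of their
  -- kernels. The full product is the minimal polynomial, whose kernel is C.
  have hspan : ∀ s ⊆ Finset.range p, LinearMap.ker (aeval (restrictCentre C δ)
      (∏ i ∈ s, (X - Polynomial.C ((i : ℕ) : constants C δ)))) ≤
        Submodule.span (constants C δ) (Set.range fun i : Fin p => w ^ (i : ℕ)) := by
    intro s
    induction s using Finset.induction_on with
    | empty =>
      intro _ x hx
      have : x = 0 := by simpa using hx
      rw [this]
      exact Submodule.zero_mem _
    | insert i s hi ih =>
      intro hs
      rw [Finset.prod_insert hi, ← sup_ker_aeval_eq_ker_aeval_mul_of_coprime]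
      · exact sup_le (hker i (Finset.mem_range.mp (hs (Finset.mem_insert_self i s))))
          (ih ((Finset.subset_insert i s).trans hs))
      · refine IsCoprime.prod_right fun j hj => isCoprime_X_sub_C_of_isUnit_sub
          (sub_ne_zero.mpr fun h => ?_).isUnit
        have := CharP.natCast_injOn_Iio (constants C δ) p
          (Finset.mem_range.mp (hs (Finset.mem_insert_self i s)))
          (Finset.mem_range.mp (hs (Finset.mem_insert_of_mem hj))) h
        exact hi (this ▸ hj)
  have htop : ⊤ ≤ Submodule.span (constants C δ) (Set.range fun i : Fin p => w ^ (i : ℕ)) := by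
    refine le_trans (fun x _ => ?_) (hspan _ subset_rfl)
    rw [← X_pow_char_sub_X_eq_prod, ← hδ, minpoly.aeval]
    rfl
  rw [Module.finrank_eq_card_basis (Module.Basis.mk hli htop), Fintype.card_fin]

end Centre

/-! ### Associativity -/

/-- If f is central, then Rf is a two-sided ideal and left factors may be reduced as well. -/
theorem Petit.isAssociativeAlgebra_of_comm {D : Type u} [DivisionRing D] {δ : RingDerivation D}
    {f : DiffPoly δ} {hf : f.Monic} (h : ∀ g, f * g = g * f) :
    IsAssociativeAlgebra (Petit f hf) := by
  intro x y z
  rw [mul_def x (y * z), mul_def y z, mk_mul_val_mk, mul_def (x * y), mul_def x y]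
  obtain ⟨q, hq⟩ := exists_modR hf (x.val * y.val)
  rw [← mul_assoc, val_mk]
  conv_rhs => rw [hq, add_mul, mk_add, mul_assoc, h, ← mul_assoc, mk_mul_self, zero_add]

section

variable {D : Type u} [DivisionRing D] (δ : RingDerivation D) (p : ℕ) (d : D)

theorem diffExt_mul_t :
    (t δ ^ p - t δ - const δ d) * t δ = t δ * (t δ ^ p - t δ - const δ d) + const δ (δ d) := by
  rw [sub_mul, sub_mul, mul_sub, mul_sub, t_mul_const, ← pow_succ, ← pow_succ']
  abel

variable [hp : Fact p.Prime]

/-- Moving a to the left past t^p - t produces δ^p(a) - δ(a), which is zero here, so only the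
commutator with d survives. -/
theorem diffExt_mul_const [CharP D p] {a : D} (ha : δ^[p] a = δ a) :
    (t δ ^ p - t δ - const δ d) * const δ a =
      const δ a * (t δ ^ p - t δ - const δ d) + const δ (a * d - d * a) := by
  have := charP_diffPoly δ p
  rw [sub_mul, sub_mul, t_pow_char_mul_const, ha, t_mul_const, map_sub, map_mul, map_mul]
  noncomm_ring

theorem isAssociativeAlgebra_of_central [CharP D p] (ha : ∀ a : D, δ^[p] a = δ a)
    (hd : ∀ a, a * d = d * a) (hd' : δ d = 0) : IsAssociativeAlgebra (GenDiffAlg δ p d) := by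
  refine Petit.isAssociativeAlgebra_of_comm fun g => ?_
  have ht : Commute (t δ ^ p - t δ - const δ d) (t δ) := by
    have := diffExt_mul_t δ p d
    rwa [hd', map_zero, add_zero] at this
  have hc : ∀ a, Commute (t δ ^ p - t δ - const δ d) (const δ a) := fun a => by
    have := diffExt_mul_const δ p d (ha a)
    rwa [hd, sub_self, map_zero, add_zero] at this
  induction g using induction_on with
  | add g h hg hh => rw [mul_add, hg, hh, add_mul]
  | mono a k => exact (hc a).mul_right (ht.pow_right k)

theorem val_mk_of_lt {g : DiffPoly δ} {k : ℕ} (hk : k < p)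
    (hg : ∀ n, k < n → DiffPoly.coeff g n = 0) : (Petit.mk g : GenDiffAlg δ p d).val = g := by
  apply Petit.val_mk_of_degree_lt
  rw [natDegree_diffExt, degree_lt_iff]
  exact fun n hn => hg n (by omega)

theorem val_mk_t : (Petit.mk (t δ) : GenDiffAlg δ p d).val = t δ :=
  val_mk_of_lt δ p d hp.out.one_lt fun n hn => by rw [coeff_t, if_neg (by omega)]

theorem val_mk_const (a : D) : (Petit.mk (const δ a) : GenDiffAlg δ p d).val = const δ a :=
  val_mk_of_lt δ p d hp.out.pos fun n hn => by rw [coeff_const, if_neg (by omega)]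

theorem mk_self : (Petit.mk (t δ ^ p - t δ - const δ d) : GenDiffAlg δ p d) = 0 :=
  Petit.mk_eq_zero_iff.mpr ⟨1, (one_mul _).symm⟩

theorem const_eq_zero_of_mk {a : D} (h : (Petit.mk (const δ a) : GenDiffAlg δ p d) = 0) :
    a = 0 := by
  apply const_injective (δ := δ)
  rw [← val_mk_const δ p d a, h, map_zero, map_zero]

/-- Apply associativity to t^(p-1), t, z. Since t^(p-1) ∘ t = t + d, one bracketing gives (t + d)z
and the other t^p z; they agree modulo Rf. -/
theorem mk_diffExt_mul_eq_zero (h : IsAssociativeAlgebra (GenDiffAlg δ p d)) {z : DiffPoly δ}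
    (hz : (Petit.mk z : GenDiffAlg δ p d).val = z) :
    (Petit.mk ((t δ ^ p - t δ - const δ d) * z) : GenDiffAlg δ p d) = 0 := by
  have h1 := h (Petit.mk (t δ ^ (p - 1))) (Petit.mk (t δ)) (Petit.mk z)
  have hx : (Petit.mk (t δ ^ (p - 1)) : GenDiffAlg δ p d).val = t δ ^ (p - 1) :=
    val_mk_of_lt δ p d (k := p - 1) (Nat.sub_lt hp.out.pos one_pos) fun n hn => by
      rw [coeff_t_pow, if_neg (by omega)]
  have hxy : (Petit.mk (t δ ^ (p - 1)) * Petit.mk (t δ) : GenDiffAlg δ p d) =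
      Petit.mk (t δ + const δ d) := by
    rw [Petit.mul_def, hx, val_mk_t, ← pow_succ, Nat.sub_add_cancel hp.out.one_le,
      ← sub_eq_zero, ← Petit.mk_sub, ← sub_sub, mk_self]
  have hv : (Petit.mk (t δ + const δ d) : GenDiffAlg δ p d).val = t δ + const δ d := by
    rw [Petit.mk_add, map_add, val_mk_t, val_mk_const]
  rw [hxy, Petit.mul_def, hv, hz, Petit.mul_def, Petit.mul_def, hx, val_mk_t, hz,
    Petit.mk_mul_val_mk, ← mul_assoc, ← pow_succ, Nat.sub_add_cancel hp.out.one_le] at h1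
  have e : (t δ ^ p - t δ - const δ d) * z = t δ ^ p * z - (t δ + const δ d) * z := by
    rw [sub_sub, sub_mul]
  refine (congrArg Petit.mk e).trans ?_
  rw [Petit.mk_sub, h1, sub_self]

/-- Both fa - af and ft - tf are constants, and associativity puts them in Rf, which contains no
nonzero constant. -/
theorem central_of_isAssociativeAlgebra [CharP D p] (ha : ∀ a : D, δ^[p] a = δ a)
    (h : IsAssociativeAlgebra (GenDiffAlg δ p d)) : (∀ a, a * d = d * a) ∧ δ d = 0 := by
  have key : ∀ (g : DiffPoly δ) (b : D),
      (Petit.mk (g * (t δ ^ p - t δ - const δ d) + const δ b) : GenDiffAlg δ p d) = 0 → b = 0 := by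
    intro g b hb
    rw [Petit.mk_add, Petit.mk_mul_self, zero_add] at hb
    exact const_eq_zero_of_mk δ p d hb
  constructor
  · intro a
    have h1 := mk_diffExt_mul_eq_zero δ p d h (val_mk_const δ p d a)
    rw [diffExt_mul_const δ p d (ha a)] at h1
    exact sub_eq_zero.mp (key _ _ h1)
  · have h1 := mk_diffExt_mul_eq_zero δ p d h (val_mk_t δ p d)
    rw [diffExt_mul_t] at h1
    exact key _ _ h1

end

/-! ### The automorphism `G_{id,-1}` -/

section Automorphism

variable (C : Type v) [Field C] {D : Type u} [DivisionRing D] [Algebra C D]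
  (δ : RingDerivation D) (p : ℕ) [hp : Fact p.Prime] [CharP D p] (d : D)

/-- `G_{id,-1}` as an `F`-automorphism of `(D, δ, d)`. -/
def shiftAut : Aut (constants C δ) (GenDiffAlg δ p d) :=
  ⟨(Petit.shiftEquiv (t δ ^ p - t δ - const δ d) (monic_diffExt δ p d) (-1)
      neg_one_mul_comm).restrictScalars (constants C δ),
    Petit.shift_mul (shift_diffExt δ p d)⟩

theorem val_shiftAut (x : GenDiffAlg δ p d) :
    ((shiftAut C δ p d).1 x).val = DiffPoly.shift δ (-1) neg_one_mul_comm x.val :=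
  Petit.val_shift x

theorem val_shiftAut_pow (k : ℕ) (x : GenDiffAlg δ p d) :
    ((shiftAut C δ p d ^ k).1 x).val =
      DiffPoly.shift δ (-(k : D)) (fun b => by rw [neg_mul, mul_neg, Nat.cast_comm]) x.val := by
  induction k with
  | zero =>
    have : DiffPoly.shift δ (-((0 : ℕ) : D)) (fun b => by simp) = RingHom.id _ :=
      ringHom_ext (by simp) (by simp)
    rw [this]
    rfl
  | succ k ih =>
    have h1 : DiffPoly.shift δ (-((k + 1 : ℕ) : D))
        (fun b => by rw [neg_mul, mul_neg, Nat.cast_comm]) =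
        (DiffPoly.shift δ (-1) neg_one_mul_comm).comp (DiffPoly.shift δ (-(k : D))
          (fun b => by rw [neg_mul, mul_neg, Nat.cast_comm])) :=
      ringHom_ext (by simp) (by simp [add_comm, add_assoc])
    rw [h1, RingHom.comp_apply, ← ih, pow_succ', ← val_shiftAut C]
    rfl

/-- The p-th power is t ↦ t - p = t, while t ↦ t - 1 moves t; p being prime, the order is p. -/
theorem orderOf_shiftAut : orderOf (shiftAut C δ p d) = p := by
  refine orderOf_eq_prime ?_ ?_
  · ext x
    apply Petit.val_injective
    have : DiffPoly.shift δ (-(p : D)) (fun b => by rw [neg_mul, mul_neg, Nat.cast_comm]) =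
        RingHom.id _ := ringHom_ext (by simp) (by simp)
    rw [val_shiftAut_pow, this]
    rfl
  · intro h
    have h1 := val_shiftAut_pow C δ p d 1 (Petit.mk (t δ))
    rw [pow_one, h, val_mk_t, shift_t] at h1
    have h2 : t δ = t δ + const δ (-((1 : ℕ) : D)) := (val_mk_t δ p d).symm.trans h1
    rw [left_eq_add, map_neg, neg_eq_zero, Nat.cast_one, map_one] at h2
    have : (1 : D) = 0 := const_injective (δ := δ) (by rw [map_one, map_zero, h2])
    exact one_ne_zero this

end Automorphism

/-! ### The theorem -/

/-- In finite dimension, injective F-linear left and right multiplications are surjective. -/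
theorem isDivisionAlgebra_of_no_zero_divisors {F : Type*} {A : Type u} [Field F] [NonAssocRing A]
    [Module F A] [IsScalarTower F A A] [SMulCommClass F A A] [FiniteDimensional F A] [Nontrivial A]
    (h : ∀ x y : A, x * y = 0 → x = 0 ∨ y = 0) : IsDivisionAlgebra A := by
  refine ⟨‹_›, fun a ha => ⟨?_, ?_⟩⟩
  · have hinj : Function.Injective (LinearMap.mulLeft F a) :=
      (injective_iff_map_eq_zero _).mpr fun x hx => (h a x hx).resolve_left ha
    exact ⟨hinj, LinearMap.injective_iff_surjective.mp hinj⟩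
  · have hinj : Function.Injective (LinearMap.mulRight F a) :=
      (injective_iff_map_eq_zero _).mpr fun x hx => (h x a hx).resolve_right ha
    exact ⟨hinj, LinearMap.injective_iff_surjective.mp hinj⟩

end DiffAlg

end

theorem mainTheorem3 {C : Type*} {D : Type*} [Field C] [DivisionRing D] [Algebra C D]
    [Algebra.IsCentral C D] [FiniteDimensional C D]
    (p : ℕ) [Fact p.Prime] [CharP C p]
    (n : ℕ) (hn : Module.finrank C D = n ^ 2)
    (δ : DiffAlg.RingDerivation D)
    (hδ : minpoly (DiffAlg.constants C δ) (DiffAlg.restrictCentre C δ) = X ^ p - X)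
    (d : D) :
    -- dimension
    Module.finrank (DiffAlg.constants C δ) (DiffAlg.GenDiffAlg δ p d) = n ^ 2 * p ^ 2 ∧
    -- division algebra
    (DiffAlg.IsDivisionAlgebra (DiffAlg.GenDiffAlg δ p d) ↔
      ∀ z : D, d ≠ DiffAlg.DiffPoly.V δ p z - z) ∧
    (DiffAlg.IsDivisionAlgebra (DiffAlg.GenDiffAlg δ p d) ↔
      ∀ z : D, DiffAlg.DiffPoly.const δ d ≠
        DiffAlg.DiffPoly.t δ ^ p - (DiffAlg.DiffPoly.t δ - DiffAlg.DiffPoly.const δ z) ^ p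
          - DiffAlg.DiffPoly.const δ z) ∧
    -- associativity, when `t ^ p - t` annihilates `δ` on all of `D`
    ((∀ a : D, δ^[p] a = δ a) →
      (DiffAlg.IsAssociativeAlgebra (DiffAlg.GenDiffAlg δ p d) ↔
        ∃ c ∈ DiffAlg.constants C δ, algebraMap C D c = d)) ∧
    -- the automorphism `G_{id,-1}` generates a cyclic group of order `p` and is trivial on `D`
    (∃ g : DiffAlg.Aut (DiffAlg.constants C δ) (DiffAlg.GenDiffAlg δ p d),
      (∀ x : DiffAlg.GenDiffAlg δ p d,
        (g.1 x).val = DiffAlg.DiffPoly.G δ (RingEquiv.refl D) (-1) x.val) ∧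
      (∀ (x : DiffAlg.GenDiffAlg δ p d) (a : D),
        x.val = DiffAlg.DiffPoly.const δ a → g.1 x = x) ∧
      Nat.card (Subgroup.zpowers g) = p) := by
  have hp : p.Prime := Fact.out
  have : CharP D p := charP_of_injective_algebraMap (algebraMap C D).injective p
  -- [C : F] = p > 0 also supplies the finiteness of C, then D, then the algebra over F.
  have hFC := DiffAlg.finrank_constants p hδ
  have : Module.Finite (DiffAlg.constants C δ) C :=
    Module.finite_of_finrank_pos (by rw [hFC]; exact hp.pos)
  have : IsScalarTower (DiffAlg.constants C δ) C D :=
    ⟨fun a b c => by rw [Subfield.smul_def, Subfield.smul_def, smul_eq_mul, mul_smul]⟩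
  have : Module.Finite (DiffAlg.constants C δ) D := Module.Finite.trans C D
  have : Module.Finite (DiffAlg.constants C δ) (DiffAlg.GenDiffAlg δ p d) :=
    Module.Finite.trans D _
  have hDA : Module.finrank D (DiffAlg.GenDiffAlg δ p d) = p :=
    DiffAlg.Petit.finrank_eq_natDegree.trans (DiffAlg.natDegree_diffExt δ p d)
  have : Nontrivial (DiffAlg.GenDiffAlg δ p d) :=
    Module.nontrivial_of_finrank_pos (R := D) (by rw [hDA]; exact hp.pos)
  have hdiv : DiffAlg.IsDivisionAlgebra (DiffAlg.GenDiffAlg δ p d) ↔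
      ∀ z : D, d ≠ DiffAlg.DiffPoly.V δ p z - z := by
    refine ⟨fun h z hz => ?_, fun h => ?_⟩
    · obtain ⟨x, y, hx, hy, hxy⟩ := DiffAlg.exists_mul_eq_zero δ p d z hz
      exact hy ((h.2 x hx).1.1 (hxy.trans (mul_zero x).symm))
    · exact DiffAlg.isDivisionAlgebra_of_no_zero_divisors (F := DiffAlg.constants C δ)
        fun x y => DiffAlg.eq_zero_of_mul_eq_zero_of_forall_ne δ p d h
  refine ⟨?_, hdiv, hdiv.trans (forall_congr' fun z => not_congr ?_), fun ha => ⟨fun h => ?_, ?_⟩,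
    DiffAlg.shiftAut C δ p d, fun x => ?_, fun x a hx => ?_, ?_⟩
  · rw [← Module.finrank_mul_finrank (DiffAlg.constants C δ) D, hDA,
      ← Module.finrank_mul_finrank (DiffAlg.constants C δ) C, hFC, hn]
    ring
  -- Here t^p - (t - z)^p is the constant V_p(z), so the two criteria compare the same elements of
  -- D.
  · rw [DiffAlg.DiffPoly.linear_pow_char, sub_sub_cancel, ← map_sub,
      DiffAlg.DiffPoly.const_injective.eq_iff]
  · obtain ⟨h1, h2⟩ := DiffAlg.central_of_isAssociativeAlgebra δ p d ha h
    obtain ⟨c, hc⟩ := Algebra.mem_bot.mp (Algebra.IsCentral.out (K := C) (D := D)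
      (Subalgebra.mem_center_iff.mpr h1))
    exact ⟨c, by rwa [DiffAlg.mem_constants, hc], hc⟩
  · rintro ⟨c, hc, rfl⟩
    exact DiffAlg.isAssociativeAlgebra_of_central δ p _ ha
      (fun a => (Algebra.commutes c a).symm) hc
  · exact DiffAlg.Petit.val_shift x
  · apply DiffAlg.Petit.val_injective
    refine (DiffAlg.Petit.val_shift x).trans ?_
    rw [hx, DiffAlg.DiffPoly.shift_const]
  · rw [Nat.card_zpowers, DiffAlg.orderOf_shiftAut]
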